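/- Let $d\ge 2$. Let $\mathcal A=\bigotimes_{\mathbb Z}M_d(\mathbb C)$ be the C*-algebra of the two-sided quantum spin chain, i.e. the C*-inductive limit of $\mathcal A_\Lambda=\bigotimes_{z\in\Lambda}M_d(\mathbb C)$, $\Lambda\subset\mathbb Z$ finite; let $\mathcal A_R,\mathcal A_L\subset\mathcal A$ be the subalgebras of the half-chains $[0,\infty)$ and $(-\infty,-1]$. Write $Q^{(j)}$ for $Q\in M_d(\mathbb C)$ at the site $j$, let $\gamma$ be the *-automorphism of $\mathcal A$ with $\gamma(Q^{(j)})=Q^{(-j-1)}$ for all $Q,j$, and let $\gamma_{L\to R}:\mathcal A_L\to\mathcal A_R$ be its restriction. For a Hilbert space $\mathcal K$, $B(\mathcal K)$ denotes the bounded operators on it. Let $\omega$ be a pure state on $\mathcal A$ with $\omega\circ\gamma=\omega$ that has the split property: if $\pi_R$ is the GNS representation of $\omega|_{\mathcal A_R}$, then $\pi_R(\mathcal A_R)''$ is a type I factor. A reflection-split representation of $\omega$ is a quadruple $(\mathcal H,\pi,\Omega,\Gamma)$ in which $\pi$ is an irreducible representation of $\mathcal A_R$ on the Hilbert space $\mathcal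 H$, $\Omega\in\mathcal H\otimes\mathcal H$ is a unit vector such that $(\mathcal H\otimes\mathcal H,\hat\pi,\Omega)$ with $\hat\pi=(\pi\circ\gamma_{L\to R})\otimes\pi$ is a GNS triple of $\omega$, and $\Gamma$ is the unitary on $\mathcal H\otimes\mathcal H$ with $\Gamma\hat\pi(A)\Omega=\hat\pi(\gamma(A))\Omega$ for all $A\in\mathcal A$. The reflection index $\sigma_\omega$ is the sign such that $\Gamma(\xi\otimes\eta)=\sigma_\omega\,\eta\otimes\xi$ for all $\xi,\eta\in\mathcal H$ in every reflection-split representation of $\omega$. Let $(\mathcal H_\omega,\pi_\omega,\Omega_\omega,\Gamma_\omega)$ be a reflection-split representation of $\omega$, and let $s_\omega\in B(\mathcal H_\omega)$ be the projection for which $1\otimes s_\omega$ is the support projection of $\Omega_\omega$ in $1\otimes B(\mathcal H_\omega)$, i.e. the smallest projection in this algebra that fixes $\Omega_\omega$. Let $\mathcal M=s_\omega\otimes B(s_\omega\mathcal H_\omega)$, acting on $s_\omega\mathcal H_\omega\otimes s_\omega\mathcal H_\omega=(s_\omega\otimes s_\omega)(\mathcal H_\omega\otimes\mathcal H_\omega)$,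 and let $J_\omega$ be the modular conjugation of $(\mathcal M,\Omega_\omega)$: the anti-unitary $J_\omega$ in the polar decomposition $S=J_\omega\Delta_\omega^{1/2}$ of the closure $S$ of $x\Omega_\omega\mapsto x^*\Omega_\omega$, $x\in\mathcal M$. Then: 1. $\sigma_\omega$ is well defined: $\sigma_\omega\in\{1,-1\}$ and $\Gamma_\omega(\xi\otimes\eta)=\sigma_\omega\,\eta\otimes\xi$ for all $\xi,\eta\in\mathcal H_\omega$. 2. There is an anti-unitary $\theta$ on $s_\omega\mathcal H_\omega$ such that $$J_\omega(s_\omega\otimes x)J_\omega^*=\theta x\theta^*\otimes s_\omega\qquad\text{for all }x\in B(s_\omega\mathcal H_\omega),\tag{$*$}$$ and there is a sign $\kappa_\omega\in\{1,-1\}$ such that $\theta^2=\kappa_\omega s_\omega$ for every anti-unitary $\theta$ with $(*)$; and $$\kappa_\omega=\sigma_\omega.$$ 3. The index can be read off from a Schmidt decomposition: if $\Omega_\omega=\sum_k\sqrt{\lambda_k}\,\xi_k\otimes\zeta_k$ with all $\lambda_k>0$ and orthonormal families $(\xi_k)$, $(\zeta_k)$ in $\mathcal H_\omega$, then both families are orthonormal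 bases of $s_\omega\mathcal H_\omega$, and the unitary $u$ and the anti-unitary $c$ on $s_\omega\mathcal H_\omega$ with $u\zeta_k=\xi_k$ and $c\zeta_k=\zeta_k$ for all $k$ satisfy $u=\sigma_\omega\,c^*u^*c$. -/

import Mathlib

open scoped InnerProductSpace ComplexOrder TensorProduct lp
open UniformSpace

universe u v

noncomputable section

/-! ### The quasi-local algebra of a quantum spin chain

The configuration space `ℓ²(ℤ → Fin d)` carries a faithful action of all single-site matrix
algebras; on the coordinates in a finite set `Λ` the algebra `⨂_{z ∈ Λ} M_d` acts as it does on
`⨂_{z ∈ Λ} ℂ^d`.  As `⨂_{z ∈ Λ} M_d` has a unique C*-norm, the norm closure of the *-algebra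
generated by the sites in `X` is the C*-inductive limit of the algebras `⨂_{z ∈ Λ} M_d`,
`Λ ⊆ X` finite. -/

namespace SpinChain

/-- Configurations: an index of the standard basis of `ℂ^d` at every site of `ℤ`. -/
abbrev Config (d : ℕ) : Type := ℤ → Fin d

/-- The Hilbert space `ℓ²(ℤ → Fin d)`. -/
abbrev ConfigSpace (d : ℕ) : Type := ℓ²(Config d, ℂ)

/-- The involution `(s, μ) ↦ (s with s j replaced by μ, s j)`. -/
def swapAt {d : ℕ} (j : ℤ) : Config d × Fin d ≃ Config d × Fin d where
  toFun p := (Function.update p.1 j p.2, p.1 j)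
  invFun p := (Function.update p.1 j p.2, p.1 j)
  left_inv p := by simp
  right_inv p := by simp

/-- The coordinate formula for the matrix `Q` acting at the site `j`. -/
def siteFun {d : ℕ} (j : ℤ) (Q : Matrix (Fin d) (Fin d) ℂ) (f : Config d → ℂ) : Config d → ℂ :=
  fun s => ∑ μ, Q (s j) μ * f (Function.update s j μ)

theorem summable_sq {d : ℕ} (f : ConfigSpace d) : Summable fun s => ‖f s‖ ^ 2 := by
  have h := (lp.memℓp f).summable (by norm_num)
  simpa using h

theorem norm_sq_eq {d : ℕ} (f : ConfigSpace d) : ‖f‖ ^ 2 = ∑' s, ‖f s‖ ^ 2 := by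
  have h := lp.norm_rpow_eq_tsum (p := 2) (by norm_num) f
  simpa using h

theorem memlp_of_summable_sq {d : ℕ} {f : Config d → ℂ} (h : Summable fun s => ‖f s‖ ^ 2) :
    Memℓp f 2 := memℓp_gen (by simpa using h)

theorem hasSum_fst {d : ℕ} {h : Config d → ℝ} (hh : Summable h) :
    HasSum (fun p : Config d × Fin d => h p.1) (∑' s, (d : ℝ) * h s) := by
  have h1 : Summable fun p : Config d × Fin d => h p.1 := by
    have := Summable.mul_of_nonneg (f := fun s => |h s|) (g := fun _ : Fin d => (1 : ℝ)) hh.abs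
      (Summable.of_finite) (fun _ => abs_nonneg _) (fun _ => zero_le_one)
    exact Summable.of_norm_bounded this (fun p => by simp)
  have h2 := h1.tsum_prod
  simp only [tsum_fintype, Finset.sum_const, Finset.card_univ, Fintype.card_fin,
    nsmul_eq_mul] at h2
  exact h2 ▸ h1.hasSum

theorem hasSum_swap {d : ℕ} (j : ℤ) {h : Config d → ℝ} (hh : Summable h) :
    HasSum (fun p : Config d × Fin d => h (Function.update p.1 j p.2))
      (∑' s, (d : ℝ) * h s) := by
  have h1 := (Equiv.hasSum_iff (swapAt j)).mpr (hasSum_fst hh)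
  have h2 : (fun p : Config d × Fin d => h (Function.update p.1 j p.2)) =
      (fun p : Config d × Fin d => h p.1) ∘ swapAt j := rfl
  rw [h2]
  exact h1

theorem hasSum_update {d : ℕ} (j : ℤ) {h : Config d → ℝ} (hh : Summable h) :
    HasSum (fun s => ∑ μ, h (Function.update s j μ)) (∑' s, (d : ℝ) * h s) :=
  (hasSum_swap j hh).prod_fiberwise fun s =>
    hasSum_fintype fun μ => h (Function.update s j μ)

theorem siteFun_sq_le {d : ℕ} (j : ℤ) (Q : Matrix (Fin d) (Fin d) ℂ) (f : Config d → ℂ)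
    (s : Config d) : ‖siteFun j Q f s‖ ^ 2 ≤
      (∑ ν, ∑ μ, ‖Q ν μ‖ ^ 2) * ∑ μ, ‖f (Function.update s j μ)‖ ^ 2 := by
  calc ‖siteFun j Q f s‖ ^ 2
      ≤ (∑ μ, ‖Q (s j) μ‖ * ‖f (Function.update s j μ)‖) ^ 2 := by
        gcongr
        exact (norm_sum_le _ _).trans (le_of_eq (by simp))
    _ ≤ (∑ μ, ‖Q (s j) μ‖ ^ 2) * ∑ μ, ‖f (Function.update s j μ)‖ ^ 2 :=
        Finset.sum_mul_sq_le_sq_mul_sq _ _ _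
    _ ≤ _ := by
        refine mul_le_mul_of_nonneg_right ?_ (by positivity)
        exact Finset.single_le_sum (f := fun ν => ∑ μ, ‖Q ν μ‖ ^ 2)
          (fun ν _ => by positivity) (Finset.mem_univ (s j))

theorem siteFun_memlp {d : ℕ} (j : ℤ) (Q : Matrix (Fin d) (Fin d) ℂ) (f : ConfigSpace d) :
    Memℓp (siteFun j Q f) 2 :=
  memlp_of_summable_sq <| Summable.of_nonneg_of_le (fun _ => by positivity)
    (siteFun_sq_le j Q f) ((hasSum_update j (summable_sq f)).summable.mul_left _)

/-- The bounded operator `Q^{(j)}`: the matrix `Q` acting at the site `j`. -/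
def siteOp {d : ℕ} (j : ℤ) (Q : Matrix (Fin d) (Fin d) ℂ) : ConfigSpace d →L[ℂ] ConfigSpace d :=
  LinearMap.mkContinuous
    { toFun := fun f => ⟨siteFun j Q f, siteFun_memlp j Q f⟩
      map_add' := fun f g => by
        ext s
        change ∑ μ, Q (s j) μ * (f _ + g _) = ∑ μ, Q (s j) μ * f _ + ∑ μ, Q (s j) μ * g _
        simp [mul_add, Finset.sum_add_distrib]
      map_smul' := fun c f => by
        ext s
        simp [siteFun, Finset.mul_sum, mul_left_comm] }
    (Real.sqrt ((∑ ν, ∑ μ, ‖Q ν μ‖ ^ 2) * d))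
    (fun f => by
      refine le_of_sq_le_sq ?_ (by positivity)
      rw [norm_sq_eq, mul_pow, Real.sq_sqrt (by positivity), norm_sq_eq]
      have h := hasSum_update j (summable_sq f)
      refine (Summable.tsum_le_tsum (siteFun_sq_le j Q f)
        (summable_sq ⟨siteFun j Q f, siteFun_memlp j Q f⟩) (h.summable.mul_left _)).trans ?_
      rw [tsum_mul_left, h.tsum_eq, tsum_mul_left, mul_assoc])

theorem siteOp_apply {d : ℕ} (j : ℤ) (Q : Matrix (Fin d) (Fin d) ℂ) (f : ConfigSpace d)
    (s : Config d) : siteOp j Q f s = ∑ μ, Q (s j) μ * f (Function.update s j μ) := rfl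

theorem siteOp_inner {d : ℕ} (j : ℤ) (Q : Matrix (Fin d) (Fin d) ℂ) (f g : ConfigSpace d) :
    ⟪siteOp j Q.conjTranspose f, g⟫_ℂ = ⟪f, siteOp j Q g⟫_ℂ := by
  let G : Config d × Fin d → ℂ := fun p =>
    starRingEnd ℂ (f p.1) * (Q (p.1 j) p.2 * g (Function.update p.1 j p.2))
  have hg := hasSum_swap j (summable_sq g)
  have hG : Summable G := by
    refine Summable.of_norm_bounded (((hasSum_fst (summable_sq f)).summable.add hg.summable).mul_left
      (∑ ν, ∑ μ, ‖Q ν μ‖)) fun p => ?_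
    have hQ : ‖Q (p.1 j) p.2‖ ≤ ∑ ν, ∑ μ, ‖Q ν μ‖ :=
      (Finset.single_le_sum (f := fun μ => ‖Q (p.1 j) μ‖) (fun _ _ => norm_nonneg _)
        (Finset.mem_univ p.2)).trans
      (Finset.single_le_sum (f := fun ν => ∑ μ, ‖Q ν μ‖) (fun ν _ => by positivity)
        (Finset.mem_univ (p.1 j)))
    simp only [G, norm_mul, RCLike.norm_conj]
    calc _ = ‖Q (p.1 j) p.2‖ * (‖f p.1‖ * ‖g (Function.update p.1 j p.2)‖) := by ring
      _ ≤ _ := by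
        refine mul_le_mul hQ ?_ (by positivity) (by positivity)
        nlinarith [sq_nonneg (‖f p.1‖ - ‖g (Function.update p.1 j p.2)‖), norm_nonneg (f p.1),
          norm_nonneg (g (Function.update p.1 j p.2)), sq_nonneg ‖f p.1‖,
          sq_nonneg ‖g (Function.update p.1 j p.2)‖]
  have hG' : Summable fun p => G (swapAt j p) := (swapAt j).summable_iff.mpr hG
  have h1 : ⟪f, siteOp j Q g⟫_ℂ = ∑' p, G p := by
    rw [lp.inner_eq_tsum, hG.tsum_prod]
    refine tsum_congr fun s => ?_
    rw [tsum_fintype, siteOp_apply, RCLike.inner_apply, Finset.sum_mul]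
    exact Finset.sum_congr rfl fun μ _ => mul_comm _ _
  have h2 : ⟪siteOp j Q.conjTranspose f, g⟫_ℂ = ∑' p, G (swapAt j p) := by
    rw [lp.inner_eq_tsum, hG'.tsum_prod]
    refine tsum_congr fun s => ?_
    rw [tsum_fintype, siteOp_apply, RCLike.inner_apply, map_sum, Finset.mul_sum]
    refine Finset.sum_congr rfl fun μ _ => ?_
    simp only [G, swapAt, Equiv.coe_fn_mk, Function.update_self, Function.update_idem,
      Function.update_eq_self, map_mul, Matrix.conjTranspose_apply, RCLike.star_def,
      RCLike.conj_conj]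
    ring
  rw [h1, h2, (swapAt j).tsum_eq G]

/-- The copy of `M_d` at the site `j`, as a *-representation on `ℓ²(ℤ → Fin d)`. -/
def siteHom (d : ℕ) (j : ℤ) :
    Matrix (Fin d) (Fin d) ℂ →⋆ₐ[ℂ] (ConfigSpace d →L[ℂ] ConfigSpace d) where
  toFun := siteOp j
  map_one' := by
    ext f s
    simp [siteOp_apply, Matrix.one_apply]
  map_mul' P Q := by
    ext f s
    change siteOp j (P * Q) f s = siteOp j P (siteOp j Q f) s
    simp only [siteOp_apply, Matrix.mul_apply, Finset.sum_mul,
      Finset.mul_sum, Function.update_self, Function.update_idem, mul_assoc]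
    rw [Finset.sum_comm]
  map_zero' := by
    ext f s
    simp [siteOp_apply]
  map_add' P Q := by
    ext f s
    simp [siteOp_apply, add_mul, Finset.sum_add_distrib]
  commutes' c := by
    ext f s
    simp [siteOp_apply, Matrix.algebraMap_matrix_apply, ite_mul]
  map_star' Q := by
    rw [Matrix.star_eq_conjTranspose, ContinuousLinearMap.star_eq_adjoint]
    exact (ContinuousLinearMap.eq_adjoint_iff _ _).mpr fun f g => siteOp_inner j Q f g

theorem siteHom_commute {d : ℕ} {i j : ℤ} (hij : i ≠ j) (P Q : Matrix (Fin d) (Fin d) ℂ) :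
    Commute (siteHom d i P) (siteHom d j Q) := by
  ext f s
  change siteOp i P (siteOp j Q f) s = siteOp j Q (siteOp i P f) s
  simp only [siteOp_apply, Finset.mul_sum, Function.update_of_ne hij,
    Function.update_of_ne hij.symm]
  rw [Finset.sum_comm]
  refine Finset.sum_congr rfl fun μ _ => Finset.sum_congr rfl fun ν _ => ?_
  rw [Function.update_comm hij]
  ring

/-- The C*-algebra of the sites in `X ⊆ ℤ`: the norm closure of the *-algebra generated by the
matrices at the sites in `X`. -/
def chainAlgebra (d : ℕ) (X : Set ℤ) : StarSubalgebra ℂ (ConfigSpace d →L[ℂ] ConfigSpace d) :=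
  (StarAlgebra.adjoin ℂ {T | ∃ j ∈ X, ∃ Q, T = siteHom d j Q}).topologicalClosure

theorem chainAlgebra_mono {d : ℕ} {X Y : Set ℤ} (h : X ⊆ Y) :
    chainAlgebra d X ≤ chainAlgebra d Y :=
  StarSubalgebra.topologicalClosure_mono <| StarAlgebra.adjoin_mono <| by
    rintro T ⟨j, hj, Q, rfl⟩
    exact ⟨j, h hj, Q, rfl⟩

/-- The algebra `𝒜` of the two-sided chain. -/
abbrev Chain (d : ℕ) : StarSubalgebra ℂ (ConfigSpace d →L[ℂ] ConfigSpace d) :=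
  chainAlgebra d Set.univ

/-- The algebra `𝒜_R` of the half-chain `[0, ∞)`. -/
abbrev ChainR (d : ℕ) : StarSubalgebra ℂ (ConfigSpace d →L[ℂ] ConfigSpace d) :=
  chainAlgebra d (Set.Ici 0)

/-- The algebra `𝒜_L` of the half-chain `(-∞, -1]`. -/
abbrev ChainL (d : ℕ) : StarSubalgebra ℂ (ConfigSpace d →L[ℂ] ConfigSpace d) :=
  chainAlgebra d (Set.Iic (-1))

/-- The inclusion `𝒜_R → 𝒜`. -/
def inclR (d : ℕ) : ChainR d →⋆ₐ[ℂ] Chain d :=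
  StarAlgHom.codRestrict (ChainR d).subtype (Chain d)
    fun a => chainAlgebra_mono (Set.subset_univ _) a.2

/-- The inclusion `𝒜_L → 𝒜`. -/
def inclL (d : ℕ) : ChainL d →⋆ₐ[ℂ] Chain d :=
  StarAlgHom.codRestrict (ChainL d).subtype (Chain d)
    fun a => chainAlgebra_mono (Set.subset_univ _) a.2

theorem coe_inclR {d : ℕ} (a : ChainR d) :
    (inclR d a : ConfigSpace d →L[ℂ] ConfigSpace d) = a :=
  StarAlgHom.coe_codRestrict _ _ _ a

theorem coe_inclL {d : ℕ} (a : ChainL d) :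
    (inclL d a : ConfigSpace d →L[ℂ] ConfigSpace d) = a :=
  StarAlgHom.coe_codRestrict _ _ _ a

/-- The reflection `j ↦ -j-1` of the sites. -/
def refl (j : ℤ) : ℤ := -j - 1

theorem refl_refl (j : ℤ) : refl (refl j) = j := by
  simp [refl]

/-- The reflection of configurations. -/
def reflConfig (d : ℕ) : Config d ≃ Config d where
  toFun s := fun j => s (refl j)
  invFun s := fun j => s (refl j)
  left_inv s := by
    funext j
    simp [refl_refl]
  right_inv s := by
    funext j
    simp [refl_refl]

/-- The unitary on `ℓ²(ℤ → Fin d)` that reflects configurations. -/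
def reflUnitary (d : ℕ) : ConfigSpace d ≃ₗᵢ[ℂ] ConfigSpace d where
  toFun f := ⟨fun s => f (reflConfig d s),
    memlp_of_summable_sq 
      (((reflConfig d).summable_iff (f := fun s => ‖f s‖ ^ 2)).mpr (summable_sq f))⟩
  invFun f := ⟨fun s => f (reflConfig d s),
    memlp_of_summable_sq 
      (((reflConfig d).summable_iff (f := fun s => ‖f s‖ ^ 2)).mpr (summable_sq f))⟩
  left_inv f := by
    ext s
    exact congrArg f ((reflConfig d).left_inv s)
  right_inv f := by
    ext s
    exact congrArg f ((reflConfig d).left_inv s)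
  map_add' f g := by
    ext s
    rfl
  map_smul' c f := by
    ext s
    rfl
  norm_map' f := by
    refine (sq_eq_sq₀ (norm_nonneg _) (norm_nonneg _)).mp ?_
    rw [norm_sq_eq, norm_sq_eq]
    exact (reflConfig d).tsum_eq (fun s => ‖f s‖ ^ 2)

/-- Conjugation with the reflection unitary. -/
def reflConj (d : ℕ) :
    (ConfigSpace d →L[ℂ] ConfigSpace d) →⋆ₐ[ℂ] (ConfigSpace d →L[ℂ] ConfigSpace d) :=
  ((reflUnitary d).conjStarAlgEquiv :
    (ConfigSpace d →L[ℂ] ConfigSpace d) →⋆ₐ[ℂ] (ConfigSpace d →L[ℂ] ConfigSpace d))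

theorem reflConj_apply {d : ℕ} (T : ConfigSpace d →L[ℂ] ConfigSpace d) (f : ConfigSpace d) :
    reflConj d T f = reflUnitary d (T ((reflUnitary d).symm f)) := rfl

theorem reflConj_siteHom {d : ℕ} (j : ℤ) (Q : Matrix (Fin d) (Fin d) ℂ) :
    reflConj d (siteHom d j Q) = siteHom d (refl j) Q := by
  ext f s
  rw [reflConj_apply]
  change siteOp j Q ((reflUnitary d).symm f) (reflConfig d s) = siteOp (refl j) Q f s
  simp only [siteOp_apply]
  refine Finset.sum_congr rfl fun μ _ => ?_
  change Q (s (refl j)) μ * f (reflConfig d (Function.update (reflConfig d s) j μ)) = _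
  refine congrArg (fun t => Q (s (refl j)) μ * f t) (funext fun i => ?_)
  change Function.update (reflConfig d s) j μ (refl i) = _
  by_cases h : i = refl j
  · subst h
    simp [refl_refl]
  · have h' : refl i ≠ j := fun e => h (by rw [← e, refl_refl])
    rw [Function.update_of_ne h, Function.update_of_ne h']
    exact congrArg s (refl_refl i)

theorem reflConj_mem {d : ℕ} {X Y : Set ℤ} (h : ∀ j ∈ X, refl j ∈ Y)
    {T : ConfigSpace d →L[ℂ] ConfigSpace d} (hT : T ∈ chainAlgebra d X) :
    reflConj d T ∈ chainAlgebra d Y := by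
  have hc : Continuous (reflConj d) :=
    (reflUnitary d).toContinuousLinearEquiv.conjContinuousAlgEquiv.continuous
  have hle : chainAlgebra d X ≤ (chainAlgebra d Y).comap (reflConj d) := by
    refine StarSubalgebra.topologicalClosure_minimal (StarAlgebra.adjoin_le ?_) ?_
    · rintro _ ⟨j, hj, Q, rfl⟩
      change reflConj d (siteHom d j Q) ∈ chainAlgebra d Y
      rw [reflConj_siteHom]
      exact StarSubalgebra.le_topologicalClosure _
        (StarAlgebra.subset_adjoin ℂ _ ⟨refl j, h j hj, Q, rfl⟩)
    · exact (StarSubalgebra.isClosed_topologicalClosure _).preimage hc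
  exact hle hT

/-- The restriction of the reflection to a *-homomorphism between the algebras of the sites in `X`
and in `Y ⊇ -X-1`. -/
def reflHom (d : ℕ) (X Y : Set ℤ) (h : ∀ j ∈ X, refl j ∈ Y) :
    chainAlgebra d X →⋆ₐ[ℂ] chainAlgebra d Y :=
  StarAlgHom.codRestrict ((reflConj d).comp (chainAlgebra d X).subtype) (chainAlgebra d Y)
    fun T => reflConj_mem h T.2

theorem coe_reflHom {d : ℕ} {X Y : Set ℤ} (h : ∀ j ∈ X, refl j ∈ Y) (a : chainAlgebra d X) :
    (reflHom d X Y h a : ConfigSpace d →L[ℂ] ConfigSpace d) = reflConj d a :=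
  StarAlgHom.coe_codRestrict _ _ _ a

/-- The reflection `γ` of `𝒜`, with `γ (Q^{(j)}) = Q^{(-j-1)}`. -/
def reflection (d : ℕ) : Chain d →⋆ₐ[ℂ] Chain d :=
  reflHom d Set.univ Set.univ fun _ _ => Set.mem_univ _

/-- The restriction `γ_{L → R} : 𝒜_L → 𝒜_R` of the reflection. -/
def reflectionLR (d : ℕ) : ChainL d →⋆ₐ[ℂ] ChainR d :=
  reflHom d (Set.Iic (-1)) (Set.Ici 0) fun j hj => by
    simp only [Set.mem_Iic, Set.mem_Ici, refl] at *
    omega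

theorem reflection_inclL {d : ℕ} (a : ChainL d) :
    reflection d (inclL d a) = inclR d (reflectionLR d a) := by
  refine Subtype.ext ?_
  rw [coe_inclR, reflection, reflectionLR, coe_reflHom, coe_reflHom, coe_inclL]

theorem reflection_reflection {d : ℕ} (a : Chain d) : reflection d (reflection d a) = a := by
  refine Subtype.ext ?_
  rw [reflection, coe_reflHom, coe_reflHom]
  ext f s
  change (a : ConfigSpace d →L[ℂ] ConfigSpace d) (reflUnitary d (reflUnitary d f))
    (reflConfig d (reflConfig d s)) = _
  have h1 : reflUnitary d (reflUnitary d f) = f := (reflUnitary d).left_inv f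
  have h2 : reflConfig d (reflConfig d s) = s := (reflConfig d).left_inv s
  rw [h1, h2]

/-- The element `Q^{(j)}` of `𝒜`. -/
def site {d : ℕ} (j : ℤ) (Q : Matrix (Fin d) (Fin d) ℂ) : Chain d :=
  ⟨siteHom d j Q, StarSubalgebra.le_topologicalClosure _
    (StarAlgebra.subset_adjoin ℂ _ ⟨j, Set.mem_univ j, Q, rfl⟩)⟩

theorem reflection_site {d : ℕ} (j : ℤ) (Q : Matrix (Fin d) (Fin d) ℂ) :
    reflection d (site j Q) = site (-j - 1) Q :=
  Subtype.ext (reflConj_siteHom j Q)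

end SpinChain

/-! ### States, representations and von Neumann algebras -/

section Operator

/-- A state: a positive normalized linear functional. -/
def IsState {A : Type*} [Ring A] [StarRing A] [Algebra ℂ A] (φ : A →ₗ[ℂ] ℂ) : Prop :=
  φ 1 = 1 ∧ ∀ a, 0 ≤ φ (star a * a)

/-- A pure state: an extreme point of the set of states. -/
def IsPureState {A : Type*} [Ring A] [StarRing A] [Algebra ℂ A] (φ : A →ₗ[ℂ] ℂ) : Prop :=
  φ ∈ Set.extremePoints ℝ {ψ : A →ₗ[ℂ] ℂ | IsState ψ}

variable {H : Type*} [NormedAddCommGroup H] [InnerProductSpace ℂ H] [CompleteSpace H]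

/-- `(H, π, Ω)` is a GNS triple of `φ`: the vector `Ω` is cyclic for the representation `π` and
implements `φ`. -/
structure IsGNSTriple {A : Type*} [Ring A] [StarRing A] [Algebra ℂ A] (φ : A →ₗ[ℂ] ℂ)
    (π : A →⋆ₐ[ℂ] (H →L[ℂ] H)) (Ω : H) : Prop where
  inner_eq : ∀ a, ⟪Ω, π a Ω⟫_ℂ = φ a
  cyclic : Dense (Set.range fun a => π a Ω)

/-- A representation on a nonzero Hilbert space is irreducible if `0` and the whole space are the
only closed invariant subspaces. -/
structure IsIrreducibleRep {A : Type*} [Ring A] [StarRing A] [Algebra ℂ A]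
    (π : A →⋆ₐ[ℂ] (H →L[ℂ] H)) : Prop where
  nontrivial : Nontrivial H
  eq_bot_or_eq_top : ∀ V : Submodule ℂ H, IsClosed (V : Set H) →
    (∀ a, ∀ v ∈ V, π a v ∈ V) → V = ⊥ ∨ V = ⊤

/-- The von Neumann algebra `π(A)''` generated by a representation. -/
def generatedVN {A : Type*} [Ring A] [StarRing A] [Algebra ℂ A]
    (π : A →⋆ₐ[ℂ] (H →L[ℂ] H)) : VonNeumannAlgebra H where
  toStarSubalgebra := StarSubalgebra.centralizer ℂ
    (StarSubalgebra.centralizer ℂ (Set.range π) : Set (H →L[ℂ] H))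
  centralizer_centralizer' := by simp

/-- A type I factor: the center is trivial and there is a nonzero abelian projection. -/
structure IsTypeIFactor (M : VonNeumannAlgebra H) : Prop where
  nontrivial : Nontrivial H
  center : ∀ z ∈ M, z ∈ M.commutant → ∃ c : ℂ, z = c • (1 : H →L[ℂ] H)
  abelian : ∃ e ∈ M, IsStarProjection e ∧ e ≠ 0 ∧
    ∀ x ∈ M, ∀ y ∈ M, Commute (e * x * e) (e * y * e)

/-- `q` is the support projection of the vector `Ω` in the von Neumann algebra `M`: the smallest
projection of `M` that fixes `Ω`. -/
structure IsSupportProjection (M : Set (H →L[ℂ] H)) (Ω : H) (q : H →L[ℂ] H) : Prop where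
  mem : q ∈ M
  proj : IsStarProjection q
  apply_eq : q Ω = Ω
  le : ∀ r ∈ M, IsStarProjection r → r Ω = Ω → r * q = q

/-- The graph of the antilinear operator `S₀ : x Ω ↦ x* Ω`, `x ∈ M`. -/
def tomitaGraph (M : Set (H →L[ℂ] H)) (Ω : H) : Set (H × H) :=
  {p | ∃ x ∈ M, p = (x Ω, ContinuousLinearMap.adjoint x Ω)}

/-- `J` is the modular conjugation of `(M, Ω)`: the closure `S` of `x Ω ↦ x* Ω` has the polar
decomposition `S = J D`, with `J` anti-unitary and `D` (which is `Δ^{1/2}`) positive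
self-adjoint. -/
def IsModularConjugation (M : Set (H →L[ℂ] H)) (Ω : H) (J : H ≃ₗᵢ⋆[ℂ] H) : Prop :=
  ∃ D : H →ₗ.[ℂ] H, IsSelfAdjoint D ∧ (∀ v : D.domain, 0 ≤ ⟪(v : H), D v⟫_ℂ) ∧
    closure (tomitaGraph M Ω) = {p | ∃ v : D.domain, p = ((v : H), J (D v))}

end Operator

/-! ### Hilbert space tensor products -/

section Tensor

/-- The Hilbert space tensor product. -/
abbrev HilbertTensor (E F : Type*) [NormedAddCommGroup E] [InnerProductSpace ℂ E]
    [NormedAddCommGroup F] [InnerProductSpace ℂ F] : Type _ := Completion (E ⊗[ℂ] F)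

variable {E F E' F' : Type*} [NormedAddCommGroup E] [InnerProductSpace ℂ E]
  [NormedAddCommGroup F] [InnerProductSpace ℂ F]
  [NormedAddCommGroup E'] [InnerProductSpace ℂ E']
  [NormedAddCommGroup F'] [InnerProductSpace ℂ F']

/-- The vector `ξ ⊗ η`. -/
def tensorVec (ξ : E) (η : F) : HilbertTensor E F := ((ξ ⊗ₜ[ℂ] η : E ⊗[ℂ] F) : Completion _)

/-- The bounded operator `a ⊗ b`. -/
def tensorOp (a : E →L[ℂ] E') (b : F →L[ℂ] F') : HilbertTensor E F →L[ℂ] HilbertTensor E' F' :=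
  (TensorProduct.mapL a b).completion

theorem tensorOp_tensorVec (a : E →L[ℂ] E') (b : F →L[ℂ] F') (ξ : E) (η : F) :
    tensorOp a b (tensorVec ξ η) = tensorVec (a ξ) (b η) := by
  simp [tensorOp, tensorVec]

variable (E F) in
/-- The von Neumann algebra `1 ⊗ B(F)` on `E ⊗ F`. -/
def rightFactor : Set (HilbertTensor E F →L[ℂ] HilbertTensor E F) :=
  Set.range fun x : F →L[ℂ] F => tensorOp (ContinuousLinearMap.id ℂ E) x

end Tensor

/-! ### Reflection-split representations and the two signs -/

namespace SpinChain

/-- The split property: if `(H, π, Ω)` is the GNS triple of the restriction of `ω` to `𝒜_R`, then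
`π(𝒜_R)''` is a type I factor. -/
def HasSplitProperty {d : ℕ} (ω : Chain d →ₗ[ℂ] ℂ) : Prop :=
  ∃ (H : Type) (_ : NormedAddCommGroup H) (_ : InnerProductSpace ℂ H) (_ : CompleteSpace H)
    (π : ChainR d →⋆ₐ[ℂ] (H →L[ℂ] H)) (Ω : H),
    IsGNSTriple (ω ∘ₗ (inclR d).toLinearMap) π Ω ∧ IsTypeIFactor (generatedVN π)

variable {H : Type u} [NormedAddCommGroup H] [InnerProductSpace ℂ H] [CompleteSpace H]

/-- `ρ` is the representation `(π ∘ γ_{L → R}) ⊗ π` of `𝒜 = 𝒜_L ⊗ 𝒜_R` on `H ⊗ H`. -/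
def IsDoubledRep {d : ℕ} (π : ChainR d →⋆ₐ[ℂ] (H →L[ℂ] H))
    (ρ : Chain d →⋆ₐ[ℂ] (HilbertTensor H H →L[ℂ] HilbertTensor H H)) : Prop :=
  ∀ (a : ChainL d) (b : ChainR d),
    ρ (inclL d a * inclR d b) = tensorOp (π (reflectionLR d a)) (π b)

/-- `(H, π, Ω, Γ)` is a reflection-split representation associated to `ω`. -/
structure IsReflectionSplitRep {d : ℕ} (ω : Chain d →ₗ[ℂ] ℂ)
    (π : ChainR d →⋆ₐ[ℂ] (H →L[ℂ] H)) (Ω : HilbertTensor H H)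
    (Γ : HilbertTensor H H ≃ₗᵢ[ℂ] HilbertTensor H H) : Prop where
  irreducible : IsIrreducibleRep π
  norm_eq_one : ‖Ω‖ = 1
  exists_rep : ∃ ρ : Chain d →⋆ₐ[ℂ] (HilbertTensor H H →L[ℂ] HilbertTensor H H),
    IsDoubledRep π ρ ∧ IsGNSTriple ω ρ Ω ∧ ∀ a, Γ (ρ a Ω) = ρ (reflection d a) Ω

/-- `σ` is a sign with `Γ (ξ ⊗ η) = σ (η ⊗ ξ)` in every reflection-split representation of `ω`. -/
def IsReflectionIndex {d : ℕ} (ω : Chain d →ₗ[ℂ] ℂ) (σ : ℤ) : Prop :=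
  (σ = 1 ∨ σ = -1) ∧
    ∀ (H : Type u) [NormedAddCommGroup H] [InnerProductSpace ℂ H] [CompleteSpace H]
      (π : ChainR d →⋆ₐ[ℂ] (H →L[ℂ] H)) (Ω : HilbertTensor H H)
      (Γ : HilbertTensor H H ≃ₗᵢ[ℂ] HilbertTensor H H),
      IsReflectionSplitRep ω π Ω Γ → ∀ ξ η : H, Γ (tensorVec ξ η) = σ • tensorVec η ξ

/-- The reflection index `σ_ω`. -/
def reflectionIndex {d : ℕ} (ω : Chain d →ₗ[ℂ] ℂ) : ℤ :=
  Classical.epsilon (IsReflectionIndex.{u} ω)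

/-- The subspace `s H`. -/
abbrev corner (s : H →L[ℂ] H) : Submodule ℂ H := s.range

/-- The vector `(s ⊗ s) Ω`, as an element of `s H ⊗ s H`, the range of `s ⊗ s`. -/
def cornerVec (s : H →L[ℂ] H) (Ω : HilbertTensor H H) :
    HilbertTensor (corner s) (corner s) :=
  tensorOp s.rangeRestrict s.rangeRestrict Ω

/-- The operator `θ x θ*`, for an anti-unitary `θ`. -/
def antiConj {K : Type*} [NormedAddCommGroup K] [InnerProductSpace ℂ K] (θ : K ≃ₗᵢ⋆[ℂ] K)
    (x : K →L[ℂ] K) : K →L[ℂ] K :=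
  (θ : K →L⋆[ℂ] K).comp (x.comp (θ.symm : K →L⋆[ℂ] K))

/-- The anti-unitary `θ` satisfies `J (1 ⊗ x) J* = θ x θ* ⊗ 1` for all bounded `x`. -/
def Implements {K : Type*} [NormedAddCommGroup K] [InnerProductSpace ℂ K]
    (J : HilbertTensor K K ≃ₗᵢ⋆[ℂ] HilbertTensor K K) (θ : K ≃ₗᵢ⋆[ℂ] K) : Prop :=
  ∀ x : K →L[ℂ] K, antiConj J (tensorOp (ContinuousLinearMap.id ℂ K) x) =
    tensorOp (antiConj θ x) (ContinuousLinearMap.id ℂ K)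

end SpinChain

end

/-!
A bounded operator `V` that intertwines tensor products of irreducible representations is, by
Schur's lemma applied to its slices, a multiple of `K ⊗ L` for intertwiners `K`, `L` of the
factors. Applied to `Γ` composed with the flip `F`, this gives `Γ = σ F`, where `σ = ±1` since `Γ`
and `F` are involutions; applied to the intertwiner of two representations, it gives a multiple of
`K ⊗ K`, which commutes with the flips, so that `σ` depends only on `ω`.

A vector `Φ` of `E ⊗ F` is the same as an antilinear Hilbert–Schmidt operator `T : F → E`, and
`F Φ` corresponds to `T*`. Hence `F Ω = σ Ω` says that `T* = σ T`. On the support of `Ω` the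
operator `T` is injective and has a Schmidt decomposition `T b_k = r_k b'_k`, and `T* = σ T` forces
`θ² = σ` for the anti-unitary `θ : b_k ↦ b'_k`. The vectors `b'_j ⊗ b_i` are eigenvectors of
`Δ^{1/2}` with eigenvalues `r_i / r_j`, so that the modular conjugation is
`θ f ⊗ e ↦ θ e ⊗ f`, which is implemented by `θ`.
-/

noncomputable section

section TensorProduct

variable {E F E' F' : Type*} [NormedAddCommGroup E] [InnerProductSpace ℂ E]
  [NormedAddCommGroup F] [InnerProductSpace ℂ F]
  [NormedAddCommGroup E'] [InnerProductSpace ℂ E']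
  [NormedAddCommGroup F'] [InnerProductSpace ℂ F']

theorem inner_tensorVec (ξ ξ' : E) (η η' : F) :
    ⟪tensorVec ξ η, tensorVec ξ' η'⟫_ℂ = ⟪ξ, ξ'⟫_ℂ * ⟪η, η'⟫_ℂ := by
  simp [tensorVec]

theorem norm_tensorVec (ξ : E) (η : F) : ‖tensorVec ξ η‖ = ‖ξ‖ * ‖η‖ := by
  simp [tensorVec]

variable (E F) in
/-- The tensor product of vectors as a bounded bilinear map. -/
def tensorVecL : E →L[ℂ] F →L[ℂ] HilbertTensor E F :=
  (ContinuousLinearMap.compL ℂ F (E ⊗[ℂ] F) (HilbertTensor E F) Completion.toComplL).comp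
    (TensorProduct.mkL ℂ E F)

theorem tensorVecL_apply (ξ : E) (η : F) : tensorVecL E F ξ η = tensorVec ξ η := rfl

theorem smul_tensorVec (c : ℂ) (ξ : E) (η : F) : tensorVec (c • ξ) η = c • tensorVec ξ η :=
  (tensorVecL E F).map_smul₂ c ξ η

theorem dense_span_tensorVec :
    Dense (Submodule.span ℂ (Set.range fun p : E × F => tensorVec p.1 p.2) :
      Set (HilbertTensor E F)) := by
  refine (Completion.denseRange_coe (α := E ⊗[ℂ] F)).mono ?_
  rintro _ ⟨x, rfl⟩
  induction x with
  | zero =>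
    rw [Completion.coe_zero]
    exact Submodule.zero_mem _
  | tmul ξ η => exact Submodule.subset_span ⟨(ξ, η), rfl⟩
  | add x y hx hy =>
    rw [Completion.coe_add]
    exact Submodule.add_mem _ hx hy

theorem ext_tensorVec {σ : ℂ →+* ℂ} {G : Type*} [NormedAddCommGroup G] [NormedSpace ℂ G]
    {f g : HilbertTensor E F →SL[σ] G} (h : ∀ ξ η, f (tensorVec ξ η) = g (tensorVec ξ η)) :
    f = g :=
  ContinuousLinearMap.ext_on dense_span_tensorVec <| Set.forall_mem_range.mpr fun p => h p.1 p.2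

theorem ext_inner_tensorVec {Φ Ψ : HilbertTensor E F}
    (h : ∀ ξ η, ⟪tensorVec ξ η, Φ⟫_ℂ = ⟪tensorVec ξ η, Ψ⟫_ℂ) : Φ = Ψ := by
  have hΦΨ : innerSLFlip ℂ Φ = innerSLFlip ℂ Ψ := ext_tensorVec h
  exact ext_inner_left ℂ (DFunLike.congr_fun hΦΨ)

theorem tensorOp_id : tensorOp (.id ℂ E) (.id ℂ F) = .id ℂ (HilbertTensor E F) :=
  ext_tensorVec fun ξ η => tensorOp_tensorVec _ _ ξ η

theorem adjoint_tensorOp [CompleteSpace E] [CompleteSpace F] [CompleteSpace E'] [CompleteSpace F']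
    (a : E →L[ℂ] E') (b : F →L[ℂ] F') : ContinuousLinearMap.adjoint (tensorOp a b) =
      tensorOp (ContinuousLinearMap.adjoint a) (ContinuousLinearMap.adjoint b) := by
  refine ext_tensorVec fun ξ η => ext_inner_tensorVec fun ξ' η' => ?_
  simp only [ContinuousLinearMap.adjoint_inner_right, tensorOp_tensorVec, inner_tensorVec]

theorem inner_tensorVec_tensorOp [CompleteSpace E] [CompleteSpace F] [CompleteSpace E']
    [CompleteSpace F'] (a : E →L[ℂ] E') (b : F →L[ℂ] F') (ξ : E') (η : F')
    (Φ : HilbertTensor E F) : ⟪tensorVec ξ η, tensorOp a b Φ⟫_ℂ =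
      ⟪tensorVec (ContinuousLinearMap.adjoint a ξ) (ContinuousLinearMap.adjoint b η), Φ⟫_ℂ := by
  rw [← tensorOp_tensorVec, ← adjoint_tensorOp, ContinuousLinearMap.adjoint_inner_left]

variable (E F) in
/-- The flip `ξ ⊗ η ↦ η ⊗ ξ`. -/
def tensorFlip : HilbertTensor E F →L[ℂ] HilbertTensor F E :=
  ((TensorProduct.commIsometry ℂ E F).toContinuousLinearEquiv :
    E ⊗[ℂ] F →L[ℂ] F ⊗[ℂ] E).completion

theorem tensorFlip_tensorVec (ξ : E) (η : F) :
    tensorFlip E F (tensorVec ξ η) = tensorVec η ξ := by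
  simp [tensorFlip, tensorVec]

theorem tensorFlip_tensorFlip (Φ : HilbertTensor E F) :
    tensorFlip F E (tensorFlip E F Φ) = Φ := by
  have h : (tensorFlip F E).comp (tensorFlip E F) = ContinuousLinearMap.id ℂ _ :=
    ext_tensorVec fun ξ η => by simp [tensorFlip_tensorVec]
  exact DFunLike.congr_fun h Φ

theorem tensorFlip_tensorOp (a : E →L[ℂ] E') (b : F →L[ℂ] F') (Φ : HilbertTensor E F) :
    tensorFlip E' F' (tensorOp a b Φ) = tensorOp b a (tensorFlip E F Φ) := by
  have h : (tensorFlip E' F').comp (tensorOp a b) = (tensorOp b a).comp (tensorFlip E F) :=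
    ext_tensorVec fun ξ η => by simp [tensorFlip_tensorVec, tensorOp_tensorVec]
  exact DFunLike.congr_fun h Φ

theorem hasSum_tensorFlip {ι : Type*} {r : ι → ℂ} {ξ : ι → E} {ζ : ι → F}
    {Φ : HilbertTensor E F} (h : HasSum (fun k => r k • tensorVec (ξ k) (ζ k)) Φ) :
    HasSum (fun k => r k • tensorVec (ζ k) (ξ k)) (tensorFlip E F Φ) := by
  simpa only [map_smul, tensorFlip_tensorVec] using h.mapL (tensorFlip E F)

theorem inner_tensorVec_tensorFlip (ξ : F) (η : E) (Φ : HilbertTensor E F) :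
    ⟪tensorVec ξ η, tensorFlip E F Φ⟫_ℂ = ⟪tensorVec η ξ, Φ⟫_ℂ := by
  have h : (innerSL ℂ (tensorVec ξ η)).comp (tensorFlip E F) = innerSL ℂ (tensorVec η ξ) :=
    ext_tensorVec fun ξ' η' => by
      simp [tensorFlip_tensorVec, inner_tensorVec, mul_comm]
  exact DFunLike.congr_fun h Φ

theorem tensorVec_right_injective {ξ : E} (hξ : ξ ≠ 0) :
    Function.Injective (tensorVec ξ : F → HilbertTensor E F) := by
  refine (injective_iff_map_eq_zero (tensorVecL E F ξ)).mpr fun η hη => ?_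
  rw [tensorVecL_apply, ← norm_eq_zero, norm_tensorVec] at hη
  simpa [hξ] using hη

theorem tensorOp_right_injective [Nontrivial E] : Function.Injective
    fun b : F →L[ℂ] F' => tensorOp (.id ℂ E) b := by
  intro b b' h
  obtain ⟨ξ, hξ⟩ := exists_ne (0 : E)
  refine ContinuousLinearMap.ext fun η => tensorVec_right_injective hξ ?_
  simpa only [tensorOp_tensorVec, ContinuousLinearMap.id_apply] using
    DFunLike.congr_fun h (tensorVec ξ η)

theorem tensorOp_left_injective [Nontrivial F] : Function.Injective
    fun a : E →L[ℂ] E' => tensorOp a (.id ℂ F) := by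
  refine fun a a' h => tensorOp_right_injective (E := F) (ext_tensorVec fun η ξ => ?_)
  rw [← tensorFlip_tensorVec, ← tensorFlip_tensorOp, ← tensorFlip_tensorOp]
  exact congrArg (fun T => tensorFlip E' F (T (tensorVec ξ η))) h

theorem tensorOp_mul (a a' : E →L[ℂ] E) (b b' : F →L[ℂ] F) :
    tensorOp a b * tensorOp a' b' = tensorOp (a * a') (b * b') :=
  ext_tensorVec fun ξ η => by
    simp only [mul_apply_eq_comp, tensorOp_tensorVec]

theorem isStarProjection_tensorOp [CompleteSpace E] [CompleteSpace F] {p : E →L[ℂ] E}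
    {q : F →L[ℂ] F} (hp : IsStarProjection p) (hq : IsStarProjection q) :
    IsStarProjection (tensorOp p q) where
  isIdempotentElem := by
    rw [IsIdempotentElem, tensorOp_mul, hp.isIdempotentElem.eq, hq.isIdempotentElem.eq]
  isSelfAdjoint := by
    rw [ContinuousLinearMap.isSelfAdjoint_iff', adjoint_tensorOp, hp.isSelfAdjoint.adjoint_eq,
      hq.isSelfAdjoint.adjoint_eq]

end TensorProduct

section AntiOp

variable {E F E' F' : Type*} [NormedAddCommGroup E] [InnerProductSpace ℂ E] [CompleteSpace E]
  [NormedAddCommGroup F] [InnerProductSpace ℂ F]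
  [NormedAddCommGroup E'] [InnerProductSpace ℂ E'] [CompleteSpace E']
  [NormedAddCommGroup F'] [InnerProductSpace ℂ F']

/-- The correspondence between vectors `Φ` of `E ⊗ F` and antilinear Hilbert–Schmidt operators
`T : F → E`, given by `⟪ξ, T η⟫ = ⟪ξ ⊗ η, Φ⟫`; with antilinear operators no choice of a conjugation
is involved. -/
def antiOp : HilbertTensor E F →L[ℂ] F →L⋆[ℂ] E :=
  ((ContinuousLinearMap.adjoint (𝕜 := ℂ) (E := E) (F := HilbertTensor E F) :
    _ →L⋆[ℂ] (HilbertTensor E F →L[ℂ] E)).comp (tensorVecL E F).flip).flip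

theorem inner_antiOp (Φ : HilbertTensor E F) (ξ : E) (η : F) :
    ⟪ξ, antiOp Φ η⟫_ℂ = ⟪tensorVec ξ η, Φ⟫_ℂ :=
  ContinuousLinearMap.adjoint_inner_right ((tensorVecL E F).flip η) ξ Φ

theorem inner_antiOp_tensorFlip [CompleteSpace F] (Φ : HilbertTensor E F) (ξ : E) (η : F) :
    ⟪η, antiOp (tensorFlip E F Φ) ξ⟫_ℂ = ⟪ξ, antiOp Φ η⟫_ℂ := by
  rw [inner_antiOp, inner_antiOp, inner_tensorVec_tensorFlip]

theorem antiOp_injective : Function.Injective (antiOp : HilbertTensor E F → F →L⋆[ℂ] E) :=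
  fun Φ Ψ h => ext_inner_tensorVec fun ξ η => by rw [← inner_antiOp, h, inner_antiOp]

theorem antiOp_tensorVec (ξ : E) (η η' : F) :
    antiOp (tensorVec ξ η) η' = ⟪η', η⟫_ℂ • ξ := by
  refine ext_inner_left ℂ fun ξ' => ?_
  rw [inner_antiOp, inner_tensorVec, inner_smul_right, mul_comm]

theorem antiOp_tensorOp [CompleteSpace F] [CompleteSpace F'] (a : E →L[ℂ] E') (b : F →L[ℂ] F')
    (Φ : HilbertTensor E F) (η : F') :
    antiOp (tensorOp a b Φ) η = a (antiOp Φ (ContinuousLinearMap.adjoint b η)) := by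
  refine ext_inner_left ℂ fun ξ => ?_
  rw [inner_antiOp, inner_tensorVec_tensorOp, ← inner_antiOp,
    ContinuousLinearMap.adjoint_inner_left]

theorem tensorOp_id_rankOne [CompleteSpace F] (Φ : HilbertTensor E F) (e f : F) :
    tensorOp (.id ℂ E) (InnerProductSpace.rankOne ℂ e f) Φ = tensorVec (antiOp Φ f) e := by
  refine antiOp_injective (ContinuousLinearMap.ext fun η => ?_)
  rw [antiOp_tensorOp, antiOp_tensorVec, InnerProductSpace.adjoint_rankOne,
    InnerProductSpace.rankOne_apply, map_smulₛₗ, inner_conj_symm, ContinuousLinearMap.id_apply]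

theorem isCompactOperator_antiOp (Φ : HilbertTensor E F) : IsCompactOperator (antiOp Φ) := by
  have hcompact : IsClosed {f : F →L⋆[ℂ] E | IsCompactOperator f} :=
    isClosed_setOfPred_isCompactOperator
  refine (hcompact.preimage antiOp.continuous).closure_subset_iff.mpr ?_
    (dense_span_tensorVec Φ)
  intro Ψ hΨ
  change IsCompactOperator (antiOp Ψ)
  induction hΨ using Submodule.span_induction with
  | mem Ψ hΨ =>
    obtain ⟨⟨ξ, η⟩, rfl⟩ := hΨ
    rw [funext (antiOp_tensorVec ξ η)]
    exact (isCompactOperator_of_locallyCompactSpace_rng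
      (ContinuousLinearMap.toSpanSingleton ℂ ξ)).comp_clm (innerSLFlip ℂ η)
  | zero =>
    rw [map_zero]
    exact isCompactOperator_zero
  | add Ψ Ψ' _ _ hΨ hΨ' =>
    rw [map_add]
    exact hΨ.add hΨ'
  | smul c Ψ _ hΨ =>
    rw [map_smul]
    exact hΨ.smul c

end AntiOp

section Schur

open scoped ComplexStarModule

theorem spectrum_subsingleton_of_cfc_mul_eq_zero {B : Type*} [CStarAlgebra B] {b : B}
    (hb : IsSelfAdjoint b)
    (h : ∀ f g : ℝ → ℝ, cfc f b * cfc g b = 0 → cfc f b = 0 ∨ cfc g b = 0) :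
    (spectrum ℝ b).Subsingleton := by
  suffices key : ∀ x ∈ spectrum ℝ b, ∀ y ∈ spectrum ℝ b, ¬ x < y from
    fun x hx y hy => le_antisymm (not_lt.mp (key y hy x hx)) (not_lt.mp (key x hx y hy))
  intro x hx y hy hxy
  let f : ℝ → ℝ := fun t => max 0 (t - (x + y) / 2)
  let g : ℝ → ℝ := fun t => max 0 ((x + y) / 2 - t)
  have hf : Continuous f := by fun_prop
  have hg : Continuous g := by fun_prop
  have hfg : cfc f b * cfc g b = 0 := by
    rw [← cfc_mul f g b hf.continuousOn hg.continuousOn, ← cfc_const_zero ℝ b]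
    refine cfc_congr fun t _ => ?_
    rcases le_total t ((x + y) / 2) with ht | ht
    · simp [f, max_eq_left (sub_nonpos.mpr ht)]
    · simp [g, max_eq_left (sub_nonpos.mpr ht)]
  have eq_zero_on_spectrum {k : ℝ → ℝ} (hk : Continuous k) (h0 : cfc k b = 0) :
      (spectrum ℝ b).EqOn k 0 :=
    (cfc_eq_cfc_iff_eqOn hb hk.continuousOn continuousOn_const).mp (h0.trans (cfc_zero ℝ b).symm)
  rcases h f g hfg with h0 | h0
  · exact absurd (max_eq_left_iff.mp (eq_zero_on_spectrum hf h0 hy)) (by linarith)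
  · exact absurd (max_eq_left_iff.mp (eq_zero_on_spectrum hg h0 hx)) (by linarith)

variable {A : Type*} [Ring A] [StarRing A] [Algebra ℂ A]
  {H H' H'' : Type*} [NormedAddCommGroup H] [InnerProductSpace ℂ H] [CompleteSpace H]
  [NormedAddCommGroup H'] [InnerProductSpace ℂ H'] [CompleteSpace H']
  [NormedAddCommGroup H''] [InnerProductSpace ℂ H''] [CompleteSpace H'']
  {π : A →⋆ₐ[ℂ] (H →L[ℂ] H)} {π' : A →⋆ₐ[ℂ] (H' →L[ℂ] H')} {π'' : A →⋆ₐ[ℂ] (H'' →L[ℂ] H'')}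

/-- `K` is an intertwiner of the representations `π` and `π'`. -/
def Intertwines (π : A →⋆ₐ[ℂ] (H →L[ℂ] H)) (π' : A →⋆ₐ[ℂ] (H' →L[ℂ] H'))
    (K : H →L[ℂ] H') : Prop :=
  ∀ a, K ∘L π a = π' a ∘L K

theorem Intertwines.comp {K : H →L[ℂ] H'} {L : H' →L[ℂ] H''} (hL : Intertwines π' π'' L)
    (hK : Intertwines π π' K) : Intertwines π π'' (L ∘L K) := fun a => by
  rw [ContinuousLinearMap.comp_assoc, hK a, ← ContinuousLinearMap.comp_assoc, hL a,
    ContinuousLinearMap.comp_assoc]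

theorem Intertwines.adjoint {K : H →L[ℂ] H'} (hK : Intertwines π π' K) :
    Intertwines π' π (ContinuousLinearMap.adjoint K) := fun a => by
  have h := congrArg ContinuousLinearMap.adjoint (hK (star a))
  rwa [ContinuousLinearMap.adjoint_comp, ContinuousLinearMap.adjoint_comp,
    ← ContinuousLinearMap.star_eq_adjoint, ← ContinuousLinearMap.star_eq_adjoint, ← map_star,
    ← map_star, star_star, eq_comm] at h

theorem IsIrreducibleRep.eq_zero_or_eq_zero_of_mul_eq_zero (hπ : IsIrreducibleRep π)
    {S T : H →L[ℂ] H} (hS : Intertwines π π S) (hST : S * T = 0) : S = 0 ∨ T = 0 := by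
  have hker : ∀ a, ∀ v ∈ S.ker, π a v ∈ S.ker := fun a v (hv : S v = 0) => by
    change S (π a v) = 0
    rw [← ContinuousLinearMap.comp_apply, hS a, ContinuousLinearMap.comp_apply, hv, map_zero]
  have hTS : ∀ v, T v ∈ S.ker := DFunLike.congr_fun hST
  rcases hπ.eq_bot_or_eq_top S.ker S.isClosed_ker hker with h | h
  · exact Or.inr (ContinuousLinearMap.ext fun v => (Submodule.mem_bot ℂ).mp (h ▸ hTS v))
  · exact Or.inl (ContinuousLinearMap.ext fun v =>
      LinearMap.mem_ker.mp (h ▸ Submodule.mem_top : v ∈ S.ker))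

theorem IsIrreducibleRep.exists_eq_smul_one_of_isSelfAdjoint (hπ : IsIrreducibleRep π)
    {T : H →L[ℂ] H} (hT : IsSelfAdjoint T) (hTπ : Intertwines π π T) :
    ∃ r : ℝ, T = r • (1 : H →L[ℂ] H) := by
  have hspec : (spectrum ℝ T).Subsingleton :=
    spectrum_subsingleton_of_cfc_mul_eq_zero hT fun f g hfg =>
      hπ.eq_zero_or_eq_zero_of_mul_eq_zero
        (fun a => (show Commute T (π a) from hTπ a).cfc_real f) hfg
  obtain ⟨r, hr⟩ : ∃ r, spectrum ℝ T ⊆ {r} :=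
    hspec.eq_empty_or_singleton.elim (fun h => ⟨0, h ▸ Set.empty_subset _⟩)
      fun ⟨r, h⟩ => ⟨r, h.subset⟩
  exact ⟨r, (CFC.eq_algebraMap_of_spectrum_subset_singleton T r hr hT).trans
    (Algebra.algebraMap_eq_smul_one r)⟩

theorem IsIrreducibleRep.exists_eq_smul_one (hπ : IsIrreducibleRep π)
    {T : H →L[ℂ] H} (hT : Intertwines π π T) : ∃ c : ℂ, T = c • (1 : H →L[ℂ] H) := by
  have hTπ : ∀ a, Commute T (π a) := hT
  have hTπ' : ∀ a, Commute (star T) (π a) := hT.adjoint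
  obtain ⟨r, hr⟩ := hπ.exists_eq_smul_one_of_isSelfAdjoint (ℜ T).2 fun a => by
    rw [realPart_apply_coe]
    exact ((hTπ a).add_left (hTπ' a)).smul_left _
  obtain ⟨t, ht⟩ := hπ.exists_eq_smul_one_of_isSelfAdjoint (ℑ T).2 fun a => by
    rw [imaginaryPart_apply_coe]
    exact (((hTπ a).sub_left (hTπ' a)).smul_left _).smul_left _
  refine ⟨r + Complex.I * t, ?_⟩
  rw [← realPart_add_I_smul_imaginaryPart T, hr, ht, add_smul, mul_smul, Complex.coe_smul,
    Complex.coe_smul]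

theorem Intertwines.exists_eq_smul (hπ : IsIrreducibleRep π) (hπ' : IsIrreducibleRep π')
    {K L : H →L[ℂ] H'} (hK : Intertwines π π' K) (hK0 : K ≠ 0) (hL : Intertwines π π' L) :
    ∃ c : ℂ, L = c • K := by
  obtain ⟨a, ha⟩ := hπ.exists_eq_smul_one (hK.adjoint.comp hL)
  obtain ⟨b, hb⟩ := hπ'.exists_eq_smul_one (hK.comp hK.adjoint)
  have hb0 : b ≠ 0 := by
    rintro rfl
    rw [zero_smul] at hb
    have hK' : ContinuousLinearMap.adjoint K = 0 :=
      ContinuousLinearMap.adjoint_comp_self_eq_zero_iff.mp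
        (by rwa [ContinuousLinearMap.adjoint_adjoint])
    exact hK0 ((LinearIsometryEquiv.map_eq_zero_iff _).mp hK')
  have hLK : b • L = a • K := calc
    b • L = (K ∘L ContinuousLinearMap.adjoint K) ∘L L := by
      rw [hb]; rfl
    _ = K ∘L (ContinuousLinearMap.adjoint K ∘L L) := rfl
    _ = a • K := by
      rw [ha, ContinuousLinearMap.comp_smul]; rfl
  exact ⟨b⁻¹ * a, by rw [mul_smul, ← hLK, inv_smul_smul₀ hb0]⟩

end Schur

section Slices

variable {E F E' F' : Type*} [NormedAddCommGroup E] [InnerProductSpace ℂ E]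
  [NormedAddCommGroup F] [InnerProductSpace ℂ F]
  [NormedAddCommGroup E'] [InnerProductSpace ℂ E']
  [NormedAddCommGroup F'] [InnerProductSpace ℂ F']

/-- The slice `η ↦ (⟨ξ'| ⊗ 1) V (ξ ⊗ η)` of an operator between tensor products. -/
def sliceRight [CompleteSpace F'] (V : HilbertTensor E F →L[ℂ] HilbertTensor E' F') (ξ : E)
    (ξ' : E') : F →L[ℂ] F' :=
  ContinuousLinearMap.adjoint (tensorVecL E' F' ξ') ∘L V ∘L tensorVecL E F ξ

/-- The slice `ξ ↦ (1 ⊗ ⟨η'|) V (ξ ⊗ η)` of an operator between tensor products. -/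
def sliceLeft [CompleteSpace E'] (V : HilbertTensor E F →L[ℂ] HilbertTensor E' F') (η : F)
    (η' : F') : E →L[ℂ] E' :=
  ContinuousLinearMap.adjoint ((tensorVecL E' F').flip η') ∘L V ∘L (tensorVecL E F).flip η

theorem inner_sliceRight [CompleteSpace F'] (V : HilbertTensor E F →L[ℂ] HilbertTensor E' F')
    (ξ : E) (η : F) (ξ' : E') (η' : F') :
    ⟪η', sliceRight V ξ ξ' η⟫_ℂ = ⟪tensorVec ξ' η', V (tensorVec ξ η)⟫_ℂ :=
  ContinuousLinearMap.adjoint_inner_right (tensorVecL E' F' ξ') η' (V (tensorVec ξ η))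

theorem inner_sliceLeft [CompleteSpace E'] (V : HilbertTensor E F →L[ℂ] HilbertTensor E' F')
    (ξ : E) (η : F) (ξ' : E') (η' : F') :
    ⟪ξ', sliceLeft V η η' ξ⟫_ℂ = ⟪tensorVec ξ' η', V (tensorVec ξ η)⟫_ℂ :=
  ContinuousLinearMap.adjoint_inner_right ((tensorVecL E' F').flip η') ξ' (V (tensorVec ξ η))

variable [CompleteSpace E'] [CompleteSpace F'] {A B : Type*}
  [Ring A] [StarRing A] [Algebra ℂ A] [Ring B] [StarRing B] [Algebra ℂ B]
  {π' : A →⋆ₐ[ℂ] (E' →L[ℂ] E')} {ρ' : B →⋆ₐ[ℂ] (F' →L[ℂ] F')}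
  {V : HilbertTensor E F →L[ℂ] HilbertTensor E' F'}

theorem intertwines_sliceRight [CompleteSpace F] {ρ : B →⋆ₐ[ℂ] (F →L[ℂ] F)}
    (hV : ∀ b, V ∘L tensorOp (.id ℂ E) (ρ b) = tensorOp (.id ℂ E') (ρ' b) ∘L V) (ξ : E) (ξ' : E') :
    Intertwines ρ ρ' (sliceRight V ξ ξ') := fun b => by
  ext η
  refine ext_inner_left ℂ fun η' => ?_
  have h := congrArg (⟪tensorVec ξ' η', · (tensorVec ξ η)⟫_ℂ) (hV b)
  simp only [ContinuousLinearMap.comp_apply, tensorOp_tensorVec, inner_tensorVec_tensorOp,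
    ContinuousLinearMap.adjoint_id, ContinuousLinearMap.id_apply] at h
  rwa [ContinuousLinearMap.comp_apply, inner_sliceRight, ContinuousLinearMap.comp_apply,
    ← ContinuousLinearMap.adjoint_inner_left (ρ' b), inner_sliceRight]

theorem intertwines_sliceLeft [CompleteSpace E] {π : A →⋆ₐ[ℂ] (E →L[ℂ] E)}
    (hV : ∀ a, V ∘L tensorOp (π a) (.id ℂ F) = tensorOp (π' a) (.id ℂ F') ∘L V) (η : F) (η' : F') :
    Intertwines π π' (sliceLeft V η η') := fun a => by
  ext ξ
  refine ext_inner_left ℂ fun ξ' => ?_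
  have h := congrArg (⟪tensorVec ξ' η', · (tensorVec ξ η)⟫_ℂ) (hV a)
  simp only [ContinuousLinearMap.comp_apply, tensorOp_tensorVec, inner_tensorVec_tensorOp,
    ContinuousLinearMap.adjoint_id, ContinuousLinearMap.id_apply] at h
  rwa [ContinuousLinearMap.comp_apply, inner_sliceLeft, ContinuousLinearMap.comp_apply,
    ← ContinuousLinearMap.adjoint_inner_left (π' a), inner_sliceLeft]

theorem exists_eq_smul_tensorOp [CompleteSpace E] [CompleteSpace F]
    {π : A →⋆ₐ[ℂ] (E →L[ℂ] E)} {ρ : B →⋆ₐ[ℂ] (F →L[ℂ] F)} (hπ : IsIrreducibleRep π)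
    (hπ' : IsIrreducibleRep π') (hρ : IsIrreducibleRep ρ)
    (hρ' : IsIrreducibleRep ρ')
    (hVπ : ∀ a, V ∘L tensorOp (π a) (.id ℂ F) = tensorOp (π' a) (.id ℂ F') ∘L V)
    (hVρ : ∀ b, V ∘L tensorOp (.id ℂ E) (ρ b) = tensorOp (.id ℂ E') (ρ' b) ∘L V)
    {K : E →L[ℂ] E'} (hK : Intertwines π π' K) (hK0 : K ≠ 0)
    {L : F →L[ℂ] F'} (hL : Intertwines ρ ρ' L) (hL0 : L ≠ 0) :
    ∃ c : ℂ, V = c • tensorOp K L := by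
  obtain ⟨v, hv⟩ := DFunLike.ne_iff.mp hL0
  have hLv : ⟪L v, L v⟫_ℂ ≠ 0 := inner_self_ne_zero.mpr hv
  choose f hf using fun ξ ξ' => hL.exists_eq_smul hρ hρ' hL0 (intertwines_sliceRight hVρ ξ ξ')
  obtain ⟨c, hc⟩ := hK.exists_eq_smul hπ hπ' hK0 (intertwines_sliceLeft hVπ v (L v))
  have hfc (ξ : E) (ξ' : E') : f ξ ξ' * ⟪L v, L v⟫_ℂ = c * ⟪ξ', K ξ⟫_ℂ := calc
    _ = ⟪L v, sliceRight V ξ ξ' v⟫_ℂ := by rw [hf, smul_apply, inner_smul_right]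
    _ = ⟪ξ', sliceLeft V v (L v) ξ⟫_ℂ := by rw [inner_sliceRight, inner_sliceLeft]
    _ = _ := by rw [hc, smul_apply, inner_smul_right]
  refine ⟨c / ⟪L v, L v⟫_ℂ, ext_tensorVec fun ξ η => ext_inner_tensorVec fun ξ' η' => ?_⟩
  rw [← inner_sliceRight, hf, smul_apply, smul_apply, tensorOp_tensorVec, inner_smul_right,
    inner_smul_right, inner_tensorVec, eq_div_of_mul_eq hLv (hfc ξ ξ')]
  ring

end Slices

section GNS

variable {A : Type*} [Ring A] [StarRing A] [Algebra ℂ A] {φ : A →ₗ[ℂ] ℂ}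
  {H H' : Type*} [NormedAddCommGroup H] [InnerProductSpace ℂ H] [CompleteSpace H]
  {π : A →⋆ₐ[ℂ] (H →L[ℂ] H)} {Ω : H}

theorem IsGNSTriple.norm_sq (h : IsGNSTriple φ π Ω) (a : A) :
    ((‖π a Ω‖ ^ 2 : ℝ) : ℂ) = φ (star a * a) := by
  rw [← h.inner_eq, map_mul, map_star, ContinuousLinearMap.star_eq_adjoint,
    mul_apply_eq_comp, ContinuousLinearMap.adjoint_inner_right,
    inner_self_eq_norm_sq_to_K]
  simp

theorem IsGNSTriple.ext [NormedAddCommGroup H'] [NormedSpace ℂ H'] (h : IsGNSTriple φ π Ω)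
    {f g : H →L[ℂ] H'} (hfg : ∀ a, f (π a Ω) = g (π a Ω)) : f = g :=
  DFunLike.coe_injective
    (f.continuous.ext_on h.cyclic g.continuous (Set.forall_mem_range.mpr hfg))

variable [NormedAddCommGroup H'] [InnerProductSpace ℂ H'] [CompleteSpace H']
  {π' : A →⋆ₐ[ℂ] (H' →L[ℂ] H')} {Ω' : H'}

theorem IsGNSTriple.norm_eq (h : IsGNSTriple φ π Ω) (h' : IsGNSTriple φ π' Ω') (a : A) :
    ‖π a Ω‖ = ‖π' a Ω'‖ := by
  have hsq := Complex.ofReal_injective ((h.norm_sq a).trans (h'.norm_sq a).symm)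
  exact (sq_eq_sq₀ (norm_nonneg _) (norm_nonneg _)).mp hsq

theorem IsGNSTriple.intertwines_of_forall (h : IsGNSTriple φ π Ω) {U : H →L[ℂ] H'}
    (hU : ∀ a, U (π a Ω) = π' a Ω') : Intertwines π π' U := fun a => h.ext fun b => by
  rw [ContinuousLinearMap.comp_apply, ← mul_apply_eq_comp, ← map_mul, hU, map_mul,
    mul_apply_eq_comp, ContinuousLinearMap.comp_apply, hU]

theorem IsGNSTriple.exists_intertwiner (h : IsGNSTriple φ π Ω) (h' : IsGNSTriple φ π' Ω') :
    ∃ V : H →L[ℂ] H', Intertwines π π' V ∧ V Ω = Ω' := by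
  let e : A →ₗ[ℂ] H := (ContinuousLinearMap.apply ℂ H Ω).toLinearMap ∘ₗ π.toLinearMap
  let f : A →ₗ[ℂ] H' := (ContinuousLinearMap.apply ℂ H' Ω').toLinearMap ∘ₗ π'.toLinearMap
  have hfe : ∀ a, f.extendOfNorm e (π a Ω) = π' a Ω' := fun a =>
    LinearMap.extendOfNorm_eq (f := f) (e := e) h.cyclic
      ⟨1, fun x => by rw [one_mul]; exact (h.norm_eq h' x).ge⟩ a
  exact ⟨f.extendOfNorm e, h.intertwines_of_forall hfe, by simpa using hfe 1⟩

end GNS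

namespace SpinChain

variable {d : ℕ}

/-- The inverse `𝒜_R → 𝒜_L` of the reflection `γ_{L → R}`. -/
def reflectionRL (d : ℕ) : ChainR d →⋆ₐ[ℂ] ChainL d :=
  reflHom d (Set.Ici 0) (Set.Iic (-1)) fun j hj => by
    simp only [Set.mem_Iic, Set.mem_Ici, refl] at *
    omega

theorem reflection_inclR (a : ChainR d) :
    reflection d (inclR d a) = inclL d (reflectionRL d a) := by
  refine Subtype.ext ?_
  rw [coe_inclL, reflection, reflectionRL, coe_reflHom, coe_reflHom, coe_inclR]

theorem reflectionLR_reflectionRL (a : ChainR d) : reflectionLR d (reflectionRL d a) = a := by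
  have h : inclR d (reflectionLR d (reflectionRL d a)) = inclR d a := by
    rw [← reflection_inclL, ← reflection_inclR, reflection_reflection]
  refine Subtype.ext ?_
  rw [← coe_inclR, h, coe_inclR]

section ReflectionSplit

variable {H H' : Type*} [NormedAddCommGroup H] [InnerProductSpace ℂ H] [CompleteSpace H]
  [NormedAddCommGroup H'] [InnerProductSpace ℂ H'] [CompleteSpace H']
  {ω : Chain d →ₗ[ℂ] ℂ} {π : ChainR d →⋆ₐ[ℂ] (H →L[ℂ] H)} {π' : ChainR d →⋆ₐ[ℂ] (H' →L[ℂ] H')}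
  {ρ : Chain d →⋆ₐ[ℂ] (HilbertTensor H H →L[ℂ] HilbertTensor H H)}
  {Ω : HilbertTensor H H} {Γ : HilbertTensor H H ≃ₗᵢ[ℂ] HilbertTensor H H}
  {Ω' : HilbertTensor H' H'} {Γ' : HilbertTensor H' H' ≃ₗᵢ[ℂ] HilbertTensor H' H'}

theorem IsDoubledRep.apply_inclR (h : IsDoubledRep π ρ) (b : ChainR d) :
    ρ (inclR d b) = tensorOp (.id ℂ H) (π b) := by
  have h1 := h 1 b
  rwa [map_one, one_mul, map_one, map_one] at h1

theorem IsDoubledRep.apply_inclL (h : IsDoubledRep π ρ) (b : ChainR d) :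
    ρ (inclL d (reflectionRL d b)) = tensorOp (π b) (.id ℂ H) := by
  have h1 := h (reflectionRL d b) 1
  rwa [map_one, mul_one, map_one, reflectionLR_reflectionRL] at h1

theorem IsReflectionSplitRep.apply_vector (h : IsReflectionSplitRep ω π Ω Γ) : Γ Ω = Ω := by
  obtain ⟨ρ, -, -, hΓ⟩ := h.exists_rep
  simpa using hΓ 1

theorem IsReflectionSplitRep.vector_ne_zero (h : IsReflectionSplitRep ω π Ω Γ) : Ω ≠ 0 :=
  norm_ne_zero_iff.mp (h.norm_eq_one ▸ one_ne_zero)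

theorem IsReflectionSplitRep.exists_eq_smul_tensorFlip (h : IsReflectionSplitRep ω π Ω Γ) :
    ∃ c : ℂ, ∀ Φ, Γ Φ = c • tensorFlip H H Φ := by
  obtain ⟨ρ, hρ, hgns, hΓ⟩ := h.exists_rep
  have := h.irreducible.nontrivial
  let G : HilbertTensor H H →L[ℂ] HilbertTensor H H := Γ
  have hG (a : Chain d) (Φ) : Γ (ρ a Φ) = ρ (reflection d a) (Γ Φ) :=
    DFunLike.congr_fun
      (hgns.intertwines_of_forall (π' := ρ.comp (reflection d)) (U := G) hΓ a) Φ
  obtain ⟨c, hc⟩ := exists_eq_smul_tensorOp (V := G ∘L tensorFlip H H)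
    h.irreducible h.irreducible h.irreducible h.irreducible
    (fun a => ContinuousLinearMap.ext fun Φ => by
      change Γ (tensorFlip H H (tensorOp _ _ Φ)) = tensorOp _ _ (Γ (tensorFlip H H Φ))
      rw [tensorFlip_tensorOp, ← hρ.apply_inclR, hG, reflection_inclR, hρ.apply_inclL])
    (fun a => ContinuousLinearMap.ext fun Φ => by
      change Γ (tensorFlip H H (tensorOp _ _ Φ)) = tensorOp _ _ (Γ (tensorFlip H H Φ))
      rw [tensorFlip_tensorOp, ← hρ.apply_inclL, hG, reflection_inclL,
        reflectionLR_reflectionRL, hρ.apply_inclR])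
    (K := .id ℂ H) (fun _ => rfl) one_ne_zero (L := .id ℂ H) (fun _ => rfl) one_ne_zero
  rw [tensorOp_id] at hc
  refine ⟨c, fun Φ => ?_⟩
  calc Γ Φ = (G ∘L tensorFlip H H) (tensorFlip H H Φ) :=
        congrArg Γ (tensorFlip_tensorFlip Φ).symm
    _ = c • tensorFlip H H Φ := by rw [hc]; rfl

theorem IsReflectionSplitRep.exists_sign (h : IsReflectionSplitRep ω π Ω Γ) :
    ∃ σ : ℤ, (σ = 1 ∨ σ = -1) ∧ ∀ ξ η : H, Γ (tensorVec ξ η) = σ • tensorVec η ξ := by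
  obtain ⟨c, hc⟩ := h.exists_eq_smul_tensorFlip
  have hΩ : c • tensorFlip H H Ω = Ω := by rw [← hc, h.apply_vector]
  have hflip : tensorFlip H H Ω = c • Ω := by
    conv_lhs => rw [← hΩ, map_smul, tensorFlip_tensorFlip]
  have hcc : c * c = 1 := smul_left_injective ℂ h.vector_ne_zero <| by
    simp only [mul_smul, one_smul, ← hflip, hΩ]
  simp only [hc, tensorFlip_tensorVec]
  rcases mul_self_eq_one_iff.mp hcc with rfl | rfl
  · exact ⟨1, .inl rfl, fun ξ η => by rw [one_smul, one_smul]⟩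
  · exact ⟨-1, .inr rfl, fun ξ η => by rw [neg_smul, neg_smul, one_smul, one_smul]⟩

theorem IsReflectionSplitRep.tensorFlip_vector (h : IsReflectionSplitRep ω π Ω Γ) {σ : ℤ}
    (hσ : σ = 1 ∨ σ = -1) (hΓ : ∀ ξ η : H, Γ (tensorVec ξ η) = σ • tensorVec η ξ) :
    tensorFlip H H Ω = σ • Ω := by
  have hflip : σ • (Γ : HilbertTensor H H →L[ℂ] HilbertTensor H H) = tensorFlip H H :=
    ext_tensorVec fun ξ η => by
      change σ • Γ (tensorVec ξ η) = _
      rw [hΓ, smul_smul, mul_self_eq_one_iff.mpr hσ, one_smul, tensorFlip_tensorVec]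
  calc tensorFlip H H Ω = σ • Γ Ω := DFunLike.congr_fun hflip.symm Ω
    _ = σ • Ω := by rw [h.apply_vector]

theorem IsReflectionSplitRep.exists_apply_vector_eq (h : IsReflectionSplitRep ω π Ω Γ)
    (h' : IsReflectionSplitRep ω π' Ω' Γ') :
    ∃ V : HilbertTensor H H →L[ℂ] HilbertTensor H' H',
      V Ω = Ω' ∧ ∀ Φ, tensorFlip H' H' (V Φ) = V (tensorFlip H H Φ) := by
  obtain ⟨ρ, hρ, hgns, -⟩ := h.exists_rep
  obtain ⟨ρ', hρ', hgns', -⟩ := h'.exists_rep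
  obtain ⟨V, hV, hVΩ⟩ := hgns.exists_intertwiner hgns'
  have hR (b) : V ∘L tensorOp (.id ℂ H) (π b) = tensorOp (.id ℂ H') (π' b) ∘L V := by
    rw [← hρ.apply_inclR, ← hρ'.apply_inclR, hV]
  have hL (b) : V ∘L tensorOp (π b) (.id ℂ H) = tensorOp (π' b) (.id ℂ H') ∘L V := by
    rw [← hρ.apply_inclL, ← hρ'.apply_inclL, hV]
  obtain ⟨ξ, ξ', hK⟩ : ∃ ξ ξ', sliceRight V ξ ξ' ≠ 0 := by
    by_contra! h0
    have hV0 : V = 0 := ext_tensorVec fun ξ η => ext_inner_tensorVec fun ξ' η' => by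
      rw [← inner_sliceRight, h0, zero_apply, zero_apply, inner_zero_right, inner_zero_right]
    exact h'.vector_ne_zero (by rw [← hVΩ, hV0, zero_apply])
  obtain ⟨c, hc⟩ := exists_eq_smul_tensorOp h.irreducible h'.irreducible h.irreducible
    h'.irreducible hL hR (intertwines_sliceRight hR ξ ξ') hK (intertwines_sliceRight hR ξ ξ') hK
  exact ⟨V, hVΩ, fun Φ => by rw [hc, smul_apply, map_smul, tensorFlip_tensorOp, smul_apply]⟩

theorem IsReflectionSplitRep.sign_unique
    (h : IsReflectionSplitRep ω π Ω Γ) (h' : IsReflectionSplitRep ω π' Ω' Γ') {σ σ' : ℤ}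
    (hσ : tensorFlip H H Ω = σ • Ω) (hσ' : tensorFlip H' H' Ω' = σ' • Ω') : σ = σ' := by
  obtain ⟨V, hVΩ, hV⟩ := h.exists_apply_vector_eq h'
  have hΩ : (σ : ℂ) • Ω' = (σ' : ℂ) • Ω' := by
    rw [Int.cast_smul_eq_zsmul, Int.cast_smul_eq_zsmul, ← hσ', ← hVΩ, hV, hσ, map_zsmul]
  exact Int.cast_injective (smul_left_injective ℂ h'.vector_ne_zero hΩ)

end ReflectionSplit

theorem IsReflectionSplitRep.isReflectionIndex {H : Type u} [NormedAddCommGroup H]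
    [InnerProductSpace ℂ H] [CompleteSpace H] {ω : Chain d →ₗ[ℂ] ℂ}
    {π : ChainR d →⋆ₐ[ℂ] (H →L[ℂ] H)} {Ω : HilbertTensor H H}
    {Γ : HilbertTensor H H ≃ₗᵢ[ℂ] HilbertTensor H H} (h : IsReflectionSplitRep ω π Ω Γ) :
    IsReflectionIndex.{u} ω (reflectionIndex.{u} ω) := by
  obtain ⟨σ, hσ, hΓ⟩ := h.exists_sign
  refine Classical.epsilon_spec (p := IsReflectionIndex.{u} ω)
    ⟨σ, hσ, fun H' _ _ _ π' Ω' Γ' h' => ?_⟩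
  obtain ⟨σ', hσ', hΓ'⟩ := h'.exists_sign
  rwa [h.sign_unique h' (h.tensorFlip_vector hσ hΓ) (h'.tensorFlip_vector hσ' hΓ')]

end SpinChain

section HilbertBasis

variable {𝕜 E ι : Type*} [RCLike 𝕜] [NormedAddCommGroup E] [InnerProductSpace 𝕜 E]

theorem ext_inner_hilbertBasis (b : HilbertBasis ι 𝕜 E) {x y : E}
    (h : ∀ k, ⟪b k, x⟫_𝕜 = ⟪b k, y⟫_𝕜) : x = y :=
  b.repr.injective <| lp.ext <| funext fun k => by
    rw [b.repr_apply_apply, b.repr_apply_apply, h]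

theorem ext_on_hilbertBasis (b : HilbertBasis ι 𝕜 E) {σ : 𝕜 →+* 𝕜} {G : Type*}
    [NormedAddCommGroup G] [NormedSpace 𝕜 G] {f g : E →SL[σ] G} (h : ∀ k, f (b k) = g (b k)) :
    f = g :=
  ContinuousLinearMap.ext_on (Submodule.dense_iff_topologicalClosure_eq_top.mpr b.dense_span)
    (Set.forall_mem_range.mpr h)

theorem exists_hilbertBasis_of_forall_inner_eq_zero [CompleteSpace E] {v : ι → E}
    (hv : Orthonormal 𝕜 v) (h : ∀ x, (∀ k, ⟪v k, x⟫_𝕜 = 0) → x = 0) :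
    ∃ b : HilbertBasis ι 𝕜 E, ⇑b = v := by
  refine ⟨.mkOfOrthogonalEqBot hv ((Submodule.eq_bot_iff _).mpr fun x hx => h x fun k => ?_),
    HilbertBasis.coe_mkOfOrthogonalEqBot hv _⟩
  exact (Submodule.mem_orthogonal _ x).mp hx _ (Submodule.subset_span ⟨k, rfl⟩)

theorem exists_hilbertBasis_eq_norm_smul [CompleteSpace E] {v : ι → E} (hv : ∀ k, v k ≠ 0)
    (hv' : ∀ i j, i ≠ j → ⟪v i, v j⟫_𝕜 = 0) (h : ∀ x, (∀ k, ⟪v k, x⟫_𝕜 = 0) → x = 0) :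
    ∃ b : HilbertBasis ι 𝕜 E, ∀ k, v k = (‖v k‖ : 𝕜) • b k := by
  let w k := (‖v k‖ : 𝕜)⁻¹ • v k
  have hvw k : v k = (‖v k‖ : 𝕜) • w k :=
    (smul_inv_smul₀ (RCLike.ofReal_ne_zero.mpr (norm_ne_zero_iff.mpr (hv k))) _).symm
  have hw : Orthonormal 𝕜 w := ⟨fun k => norm_smul_inv_norm (hv k), fun i j hij => by
    change ⟪(‖v i‖ : 𝕜)⁻¹ • v i, (‖v j‖ : 𝕜)⁻¹ • v j⟫_𝕜 = 0
    rw [inner_smul_left, inner_smul_right, hv' i j hij, mul_zero, mul_zero]⟩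
  obtain ⟨b, hb⟩ := exists_hilbertBasis_of_forall_inner_eq_zero hw fun x hx => h x fun k => by
    rw [hvw, inner_smul_left, hx, mul_zero]
  exact ⟨b, fun k => hb ▸ hvw k⟩

theorem exists_hilbertBasis_of_orthogonalFamily [CompleteSpace E] {V : ι → Submodule 𝕜 E}
    [∀ i, CompleteSpace (V i)] (hV : OrthogonalFamily 𝕜 (fun i => V i) fun i => (V i).subtypeₗᵢ)
    (hV' : (⨆ i, V i)ᗮ = ⊥) :
    ∃ (w : ∀ i, Set (V i)) (b : HilbertBasis (Σ i, w i) 𝕜 E), ∀ a, b a ∈ V a.1 := by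
  choose w b _ using fun i => exists_hilbertBasis 𝕜 (V i)
  obtain ⟨c, hc⟩ := exists_hilbertBasis_of_forall_inner_eq_zero
    (hV.orthonormal_sigma_orthonormal fun i => (b i).orthonormal) fun x hx => by
      rw [← Submodule.mem_bot 𝕜, ← hV', ← Submodule.iInf_orthogonal, Submodule.mem_iInf]
      intro i
      have hxV : (innerSL 𝕜 x).comp (V i).subtypeL = 0 :=
        ext_on_hilbertBasis (b i) fun k => inner_eq_zero_symm.mp (hx ⟨i, k⟩)
      exact (Submodule.mem_orthogonal' (V i) x).mpr fun y hy => DFunLike.congr_fun hxV ⟨y, hy⟩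
  exact ⟨w, c, fun a => hc ▸ (b a.1 a.2).2⟩

theorem exists_hilbertBasis_of_isCompactOperator {E : Type u} [NormedAddCommGroup E]
    [InnerProductSpace ℂ E] [CompleteSpace E] {T : E →L[ℂ] E} (hT : IsCompactOperator T)
    (hT' : T.IsSymmetric) : ∃ (ι : Type u) (b : HilbertBasis ι ℂ E) (μ : ι → ℂ),
      ∀ k, T (b k) = μ k • b k := by
  let V : ℂ → Submodule ℂ E := Module.End.eigenspace (T : Module.End ℂ E)
  have hmem {μ x} : x ∈ V μ ↔ T x = μ • x := Module.End.mem_eigenspace_iff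
  have hcomplete μ : CompleteSpace (V μ) := by
    have hclosed : IsClosed {x | T x = μ • x} :=
      isClosed_eq T.continuous (continuous_const_smul μ)
    rw [← show (V μ : Set E) = {x | T x = μ • x} from Set.ext fun _ => hmem] at hclosed
    exact hclosed.completeSpace_coe
  obtain ⟨w, b, hb⟩ := exists_hilbertBasis_of_orthogonalFamily (V := V)
    (LinearMap.IsSymmetric.orthogonalFamily_eigenspaces hT')
    (ContinuousLinearMap.orthogonalComplement_iSup_eigenspaces_eq_bot hT hT')
  exact ⟨_, b, fun a => a.1, fun a => hmem.mp (hb a)⟩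

end HilbertBasis

section Antiunitary

variable {E F ι : Type*} [NormedAddCommGroup E] [InnerProductSpace ℂ E]
  [NormedAddCommGroup F] [InnerProductSpace ℂ F]

theorem antiunitary_inner_map_map (θ : E ≃ₗᵢ⋆[ℂ] F) (x y : E) : ⟪θ x, θ y⟫_ℂ = ⟪y, x⟫_ℂ := by
  have hI : θ ((RCLike.I : ℂ) • x) = -((RCLike.I : ℂ) • θ x) := by
    rw [map_smulₛₗ, RCLike.conj_I, neg_smul]
  have h_sub : ‖θ y - (RCLike.I : ℂ) • θ x‖ = ‖y + (RCLike.I : ℂ) • x‖ := by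
    rw [← θ.norm_map (y + _), map_add, hI, sub_eq_add_neg]
  have h_add : ‖θ y + (RCLike.I : ℂ) • θ x‖ = ‖y - (RCLike.I : ℂ) • x‖ := by
    rw [← θ.norm_map (y - _), map_sub, hI, sub_neg_eq_add]
  rw [← inner_conj_symm, inner_eq_sum_norm_sq_div_four (θ y), inner_eq_sum_norm_sq_div_four y,
    ← map_add, ← map_sub, θ.norm_map, θ.norm_map, h_add, h_sub]
  simp only [Complex.coe_algebraMap, RCLike.I_to_complex, map_div₀, map_add, map_sub, map_pow,
    map_mul, map_ofNat, Complex.conj_ofReal, Complex.conj_I]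
  ring

/-- The anti-unitary that takes one Hilbert basis to another one. -/
def antiunitaryOfBases (b : HilbertBasis ι ℂ E) (b' : HilbertBasis ι ℂ F) : E ≃ₗᵢ⋆[ℂ] F :=
  (b.repr.trans (starₗᵢ ℂ)).trans b'.repr.symm

theorem antiunitaryOfBases_apply (b : HilbertBasis ι ℂ E) (b' : HilbertBasis ι ℂ F) (k : ι) :
    antiunitaryOfBases b b' (b k) = b' k := by
  classical
  change b'.repr.symm (star (b.repr (b k))) = b' k
  rw [b.repr_self, ← b'.repr_symm_single]
  congr 1
  ext j
  rw [lp.star_apply]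
  by_cases h : j = k
  · subst h
    simp
  · simp [h]

end Antiunitary

section Modular

variable {H : Type*} [NormedAddCommGroup H] [InnerProductSpace ℂ H] [CompleteSpace H]

theorem exists_mem_domain_apply_eq_of_isSelfAdjoint {D : H →ₗ.[ℂ] H} (hD : IsSelfAdjoint D)
    {y z : H} (h : ∀ x : D.domain, ⟪z, x⟫_ℂ = ⟪y, D x⟫_ℂ) :
    ∃ hy : y ∈ D.domain, D ⟨y, hy⟩ = z := by
  have hdom : y ∈ D.adjoint.domain := LinearPMap.mem_adjoint_domain_of_exists y ⟨z, h⟩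
  have happ : D.adjoint ⟨y, hdom⟩ = z := LinearPMap.adjoint_apply_eq hD.dense_domain ⟨y, hdom⟩ h
  have hDD : D.adjoint = D := hD
  generalize D.adjoint = D' at *
  subst hDD
  exact ⟨hdom, happ⟩

theorem apply_eq_smul_of_inner_apply_eq {D : H →ₗ.[ℂ] H} (hD : IsSelfAdjoint D)
    (hpos : ∀ v : D.domain, 0 ≤ ⟪(v : H), D v⟫_ℂ) {t : ℝ} (ht : 0 < t) (v : D.domain)
    (h : ∀ w : D.domain, ⟪D v, D w⟫_ℂ = (t : ℂ) ^ 2 * ⟪(v : H), w⟫_ℂ) :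
    D v = (t : ℂ) • (v : H) := by
  obtain ⟨hDv, hDDv⟩ := exists_mem_domain_apply_eq_of_isSelfAdjoint hD (y := D v)
    (z := (t : ℂ) ^ 2 • (v : H)) fun w => by
      rw [h, inner_smul_left, map_pow, Complex.conj_ofReal]
  -- `D u = -t u`, so positivity of `D` forces `u = 0`
  let u : D.domain := ⟨D v, hDv⟩ - (t : ℂ) • v
  have hDu : D u = -((t : ℂ) • (u : H)) := by
    change D (⟨D v, hDv⟩ - (t : ℂ) • v) = -((t : ℂ) • (D v - (t : ℂ) • (v : H)))
    rw [LinearPMap.map_sub, LinearPMap.map_smul, hDDv]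
    module
  have hle : t * ‖(u : H)‖ ^ 2 ≤ 0 := by
    have hu := hpos u
    rw [hDu, inner_neg_right, inner_smul_right, inner_self_eq_norm_sq_to_K] at hu
    have hre : (0 : ℂ) ≤ ((-(t * ‖(u : H)‖ ^ 2) : ℝ) : ℂ) := by
      push_cast
      exact hu
    exact neg_nonneg.mp (Complex.zero_le_real.mp hre)
  have hu : (u : H) = 0 := by
    by_contra hne
    exact hle.not_gt (by positivity)
  exact sub_eq_zero.mp hu

theorem IsModularConjugation.smul_apply_eq {M : Set (H →L[ℂ] H)} {Ω : H} {J : H ≃ₗᵢ⋆[ℂ] H}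
    (hJ : IsModularConjugation M Ω J) {v w : H} {t : ℝ} (ht : 0 < t)
    (hvw : (v, w) ∈ tomitaGraph M Ω)
    (h : ∀ p ∈ tomitaGraph M Ω, ⟪p.2, w⟫_ℂ = (t : ℂ) ^ 2 * ⟪v, p.1⟫_ℂ) :
    (t : ℂ) • J v = w := by
  obtain ⟨D, hD, hpos, hgraph⟩ := hJ
  have h_closure : ∀ p ∈ closure (tomitaGraph M Ω), ⟪p.2, w⟫_ℂ = (t : ℂ) ^ 2 * ⟪v, p.1⟫_ℂ :=
    closure_minimal h (isClosed_eq (by fun_prop) (by fun_prop))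
  obtain ⟨v, hv⟩ : ∃ v' : D.domain, (v, w) = ((v' : H), J (D v')) :=
    hgraph.subset (subset_closure hvw)
  obtain ⟨rfl, rfl⟩ := Prod.mk.inj hv
  have hDv : D v = (t : ℂ) • (v : H) := apply_eq_smul_of_inner_apply_eq hD hpos ht v fun u => by
    rw [← h_closure _ (hgraph.superset ⟨u, rfl⟩), antiunitary_inner_map_map]
  rw [hDv, map_smulₛₗ, Complex.conj_ofReal]

end Modular

section Schmidt

/-- A Schmidt decomposition `Φ = ∑ r k • (b' k ⊗ b k)` with positive coefficients along Hilbert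
bases of both factors, encoded as a singular value decomposition of the antilinear operator of
`Φ`. -/
structure IsSchmidt {E F ι : Type*} [NormedAddCommGroup E] [InnerProductSpace ℂ E]
    [CompleteSpace E] [NormedAddCommGroup F] [InnerProductSpace ℂ F] (Φ : HilbertTensor E F)
    (r : ι → ℝ) (b' : HilbertBasis ι ℂ E) (b : HilbertBasis ι ℂ F) : Prop where
  pos : ∀ k, 0 < r k
  antiOp_apply : ∀ k, antiOp Φ (b k) = (r k : ℂ) • b' k

variable {E F ι : Type*} [NormedAddCommGroup E] [InnerProductSpace ℂ E] [CompleteSpace E]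
  [NormedAddCommGroup F] [InnerProductSpace ℂ F] {Φ : HilbertTensor E F}

theorem IsSchmidt.symm [CompleteSpace F] {r : ι → ℝ} {b' : HilbertBasis ι ℂ E}
    {b : HilbertBasis ι ℂ F} (h : IsSchmidt Φ r b' b) : IsSchmidt (tensorFlip E F Φ) r b b' where
  pos := h.pos
  antiOp_apply k := by
    classical
    refine ext_inner_hilbertBasis b fun j => ?_
    rw [inner_antiOp_tensorFlip, h.antiOp_apply, inner_smul_right, inner_smul_right,
      orthonormal_iff_ite.mp b.orthonormal, orthonormal_iff_ite.mp b'.orthonormal]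
    by_cases hjk : j = k
    · subst hjk
      rfl
    · rw [if_neg hjk, if_neg (Ne.symm hjk), mul_zero, mul_zero]

theorem IsSchmidt.inner_antiOp_antiOp [CompleteSpace F] {r : ι → ℝ} {b' : HilbertBasis ι ℂ E}
    {b : HilbertBasis ι ℂ F} (h : IsSchmidt Φ r b' b) (k : ι) (η : F) :
    ⟪antiOp Φ (b k), antiOp Φ η⟫_ℂ = (r k : ℂ) ^ 2 * ⟪η, b k⟫_ℂ := by
  rw [← inner_antiOp_tensorFlip, h.antiOp_apply, map_smulₛₗ, h.symm.antiOp_apply, smul_smul,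
    Complex.conj_ofReal, inner_smul_right, sq]

/- The Schmidt basis diagonalizes the compact positive operator `T* T`, where `T` is the antilinear
operator of `Φ` and the antilinear operator of the flip of `Φ` is `T*`. -/
theorem exists_isSchmidt {F : Type u} [NormedAddCommGroup F] [InnerProductSpace ℂ F]
    [CompleteSpace F] {Φ : HilbertTensor E F} (hΦ : Function.Injective (antiOp Φ))
    (hΦ' : Function.Injective (antiOp (tensorFlip E F Φ))) :
    ∃ (ι : Type u) (r : ι → ℝ) (b' : HilbertBasis ι ℂ E) (b : HilbertBasis ι ℂ F),
      IsSchmidt Φ r b' b := by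
  let R : F →L[ℂ] F := (antiOp (tensorFlip E F Φ)).comp (antiOp Φ)
  have hR x y : ⟪x, R y⟫_ℂ = ⟪antiOp Φ y, antiOp Φ x⟫_ℂ := inner_antiOp_tensorFlip Φ _ x
  have hR_compact : IsCompactOperator R :=
    IsCompactOperator.comp_clm (isCompactOperator_antiOp (tensorFlip E F Φ)) (antiOp Φ)
  have hR_symm : R.IsSymmetric := fun x y => by
    change ⟪R x, y⟫_ℂ = ⟪x, R y⟫_ℂ
    rw [hR, ← inner_conj_symm, hR, inner_conj_symm]
  obtain ⟨ι, b, μ, hb⟩ := exists_hilbertBasis_of_isCompactOperator hR_compact hR_symm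
  have h_ne k : antiOp Φ (b k) ≠ 0 :=
    (map_ne_zero_iff (antiOp Φ) hΦ).mpr (b.orthonormal.ne_zero k)
  have h_orth i j (hij : i ≠ j) : ⟪antiOp Φ (b i), antiOp Φ (b j)⟫_ℂ = 0 := by
    rw [← hR, hb, inner_smul_right, b.orthonormal.2 hij.symm, mul_zero]
  obtain ⟨b', hb'⟩ := exists_hilbertBasis_eq_norm_smul h_ne h_orth fun x hx => by
    refine (map_eq_zero_iff _ hΦ').mp (ext_inner_hilbertBasis b fun k => ?_)
    rw [inner_antiOp_tensorFlip, inner_eq_zero_symm.mp (hx k), inner_zero_right]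
  exact ⟨ι, fun k => ‖antiOp Φ (b k)‖, b', b, fun k => norm_pos_iff.mpr (h_ne k), hb'⟩

variable {r : ι → ℂ} {ξ : ι → E} {ζ : ι → F}

theorem hasSum_antiOp (h : HasSum (fun k => r k • tensorVec (ξ k) (ζ k)) Φ) (η : F) :
    HasSum (fun k => (r k * ⟪η, ζ k⟫_ℂ) • ξ k) (antiOp Φ η) := by
  simpa only [ContinuousLinearMap.flip_apply, map_smul, antiOp_tensorVec, smul_smul]
    using h.mapL (antiOp.flip η)

theorem antiOp_apply_eq_smul_of_hasSum (hζ : Orthonormal ℂ ζ)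
    (h : HasSum (fun k => r k • tensorVec (ξ k) (ζ k)) Φ) (k : ι) :
    antiOp Φ (ζ k) = r k • ξ k := by
  refine (hasSum_antiOp h (ζ k)).unique ?_
  have h_single := hasSum_single (f := fun j => (r j * ⟪ζ k, ζ j⟫_ℂ) • ξ j) k fun j hj => by
    rw [hζ.2 hj.symm, mul_zero, zero_smul]
  rwa [inner_self_eq_one_of_norm_eq_one (hζ.1 k), mul_one] at h_single

theorem exists_hilbertBasis_of_hasSum [CompleteSpace F] (hΦ : Function.Injective (antiOp Φ))
    (hζ : Orthonormal ℂ ζ) (h : HasSum (fun k => r k • tensorVec (ξ k) (ζ k)) Φ) :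
    ∃ b : HilbertBasis ι ℂ F, ⇑b = ζ := by
  refine exists_hilbertBasis_of_forall_inner_eq_zero hζ fun η hη => ?_
  refine (map_eq_zero_iff _ hΦ).mp ((hasSum_antiOp h η).unique ?_)
  simp only [inner_eq_zero_symm.mp (hη _), mul_zero, zero_smul, hasSum_zero]

theorem exists_isSchmidt_of_hasSum [CompleteSpace F] {r : ι → ℝ}
    (hΦ : Function.Injective (antiOp Φ)) (hΦ' : Function.Injective (antiOp (tensorFlip E F Φ)))
    (hr : ∀ k, 0 < r k) (hξ : Orthonormal ℂ ξ) (hζ : Orthonormal ℂ ζ)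
    (h : HasSum (fun k => (r k : ℂ) • tensorVec (ξ k) (ζ k)) Φ) :
    ∃ (b' : HilbertBasis ι ℂ E) (b : HilbertBasis ι ℂ F),
      ⇑b' = ξ ∧ ⇑b = ζ ∧ IsSchmidt Φ r b' b := by
  obtain ⟨b', rfl⟩ := exists_hilbertBasis_of_hasSum hΦ' hξ (hasSum_tensorFlip h)
  obtain ⟨b, rfl⟩ := exists_hilbertBasis_of_hasSum hΦ hζ h
  exact ⟨b', b, rfl, rfl, hr, antiOp_apply_eq_smul_of_hasSum hζ h⟩

end Schmidt

section SchmidtModular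

variable {E F ι : Type*} [NormedAddCommGroup E] [InnerProductSpace ℂ E] [CompleteSpace E]
  [NormedAddCommGroup F] [InnerProductSpace ℂ F] [CompleteSpace F]
  {J : HilbertTensor E F ≃ₗᵢ⋆[ℂ] HilbertTensor E F} {Φ : HilbertTensor E F}

theorem tensorVec_antiOp_mem_tomitaGraph (Φ : HilbertTensor E F) (e f : F) :
    (tensorVec (antiOp Φ f) e, tensorVec (antiOp Φ e) f) ∈ tomitaGraph (rightFactor E F) Φ := by
  refine ⟨_, ⟨InnerProductSpace.rankOne ℂ e f, rfl⟩, ?_⟩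
  rw [adjoint_tensorOp, ContinuousLinearMap.adjoint_id, InnerProductSpace.adjoint_rankOne,
    tensorOp_id_rankOne, tensorOp_id_rankOne]

variable {r : ι → ℝ} {b' : HilbertBasis ι ℂ E} {b : HilbertBasis ι ℂ F}

theorem IsSchmidt.inner_tensorVec_tensorOp_id (h : IsSchmidt Φ r b' b) (y : F →L[ℂ] F) (k : ι)
    (η : F) : ⟪tensorVec (antiOp Φ (b k)) η, tensorOp (.id ℂ E) y Φ⟫_ℂ =
      (r k : ℂ) ^ 2 * ⟪η, y (b k)⟫_ℂ := by
  rw [← inner_antiOp, antiOp_tensorOp, ContinuousLinearMap.id_apply, h.inner_antiOp_antiOp,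
    ContinuousLinearMap.adjoint_inner_left]

/- `b' j ⊗ b i` is an eigenvector of `Δ^{1/2}` with eigenvalue `r i / r j`. -/
theorem IsSchmidt.modularConjugation_tensorVec (h : IsSchmidt Φ r b' b)
    (hJ : IsModularConjugation (rightFactor E F) Φ J) (i j : ι) :
    J (tensorVec (b' j) (b i)) = tensorVec (b' i) (b j) := by
  have hi : (r i : ℂ) ≠ 0 := by exact_mod_cast (h.pos i).ne'
  have hj : (r j : ℂ) ≠ 0 := by exact_mod_cast (h.pos j).ne'
  have h_eigen := hJ.smul_apply_eq (div_pos (h.pos i) (h.pos j))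
    (tensorVec_antiOp_mem_tomitaGraph Φ (b i) (b j)) <| by
      rintro _ ⟨_, ⟨y, rfl⟩, rfl⟩
      rw [← inner_conj_symm, adjoint_tensorOp, ContinuousLinearMap.adjoint_id,
        h.inner_tensorVec_tensorOp_id, h.inner_tensorVec_tensorOp_id, map_mul, inner_conj_symm,
        ContinuousLinearMap.adjoint_inner_left, map_pow, Complex.conj_ofReal]
      push_cast
      field_simp
  rw [h.antiOp_apply, h.antiOp_apply, smul_tensorVec, smul_tensorVec, map_smulₛₗ,
    Complex.conj_ofReal, smul_smul, Complex.ofReal_div, div_mul_cancel₀ _ hj] at h_eigen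
  exact smul_right_injective _ hi h_eigen

theorem IsSchmidt.modularConjugation_tensorVec_apply (h : IsSchmidt Φ r b' b)
    (hJ : IsModularConjugation (rightFactor E F) Φ J) {θ : F ≃ₗᵢ⋆[ℂ] E} (hθ : ∀ k, θ (b k) = b' k)
    (e f : F) : J (tensorVec (θ f) e) = tensorVec (θ e) f := by
  let Jc : HilbertTensor E F →L⋆[ℂ] HilbertTensor E F := J
  let θc : F →L⋆[ℂ] E := θ
  have h_right j : Jc.comp (tensorVecL E F (b' j)) = ((tensorVecL E F).flip (b j)).comp θc :=
    ext_on_hilbertBasis b fun i => by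
      change J (tensorVec (b' j) (b i)) = tensorVec (θ (b i)) (b j)
      rw [hθ, h.modularConjugation_tensorVec hJ]
  have h_left : (Jc.comp ((tensorVecL E F).flip e)).comp θc = tensorVecL E F (θ e) :=
    ext_on_hilbertBasis b fun j => by
      change J (tensorVec (θ (b j)) e) = tensorVec (θ e) (b j)
      rw [hθ]
      exact DFunLike.congr_fun (h_right j) e
  exact DFunLike.congr_fun h_left f

end SchmidtModular

section SchmidtSign

variable {K ι : Type*} [NormedAddCommGroup K] [InnerProductSpace ℂ K] [CompleteSpace K]
  {Φ : HilbertTensor K K} {σ : ℤ} {r : ι → ℝ} {b b' : HilbertBasis ι ℂ K}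

theorem antiOp_zsmul_apply {E F : Type*} [NormedAddCommGroup E] [InnerProductSpace ℂ E]
    [CompleteSpace E] [NormedAddCommGroup F] [InnerProductSpace ℂ F] (n : ℤ)
    (Φ : HilbertTensor E F) (η : F) : antiOp (n • Φ) η = n • antiOp Φ η :=
  map_zsmul (antiOp.flip η) n Φ

theorem IsSchmidt.inner_eq_sign_mul (h : IsSchmidt Φ r b' b) (hΦ : tensorFlip K K Φ = σ • Φ)
    (j k : ι) : ⟪b' j, b k⟫_ℂ = σ * ⟪b' k, b j⟫_ℂ := by
  have hΦ' : σ • tensorFlip K K Φ = Φ := by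
    rw [← map_zsmul, ← hΦ, tensorFlip_tensorFlip]
  have h_left : (r j : ℂ) * ⟪b' j, b k⟫_ℂ = σ * (r k * ⟪b' k, b j⟫_ℂ) := by
    have h_symm := congrArg (starRingEnd ℂ) (inner_antiOp_tensorFlip Φ (b k) (b j))
    rw [hΦ, antiOp_zsmul_apply, h.antiOp_apply, h.antiOp_apply, ← Int.cast_smul_eq_zsmul ℂ,
      inner_smul_right, inner_smul_right, inner_smul_right] at h_symm
    simpa only [map_mul, inner_conj_symm, Complex.conj_ofReal, map_intCast] using h_symm.symm
  have h_right : (r k : ℂ) * ⟪b' j, b k⟫_ℂ = σ * (r j * ⟪b' k, b j⟫_ℂ) := by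
    have h_symm := inner_antiOp_tensorFlip Φ (b' k) (b' j)
    have h_apply : antiOp Φ (b' j) = σ • (r j : ℂ) • b j := by
      rw [← h.symm.antiOp_apply, ← antiOp_zsmul_apply, hΦ']
    rwa [h_apply, h.symm.antiOp_apply, ← Int.cast_smul_eq_zsmul ℂ,
      inner_smul_right, inner_smul_right, inner_smul_right] at h_symm
  have h_ne : (r j + r k : ℂ) ≠ 0 := by
    exact_mod_cast (add_pos (h.pos j) (h.pos k)).ne'
  exact mul_left_cancel₀ h_ne (by linear_combination h_left + h_right)

theorem IsSchmidt.antiunitary_apply_apply (h : IsSchmidt Φ r b' b)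
    (hΦ : tensorFlip K K Φ = σ • Φ) {θ : K ≃ₗᵢ⋆[ℂ] K} (hθ : ∀ k, θ (b k) = b' k) (ξ : K) :
    θ (θ ξ) = σ • ξ := by
  have hθ' k : θ (b' k) = (σ : ℂ) • b k := ext_inner_hilbertBasis b' fun j => by
    rw [← hθ j, antiunitary_inner_map_map, hθ j, inner_smul_right, h.inner_eq_sign_mul hΦ]
  let θc : K →L⋆[ℂ] K := θ
  have h_comp : θc.comp θc = (σ : ℂ) • .id ℂ K := ext_on_hilbertBasis b fun k => by
    change θ (θ (b k)) = (σ : ℂ) • b k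
    rw [hθ, hθ']
  rw [← Int.cast_smul_eq_zsmul ℂ σ]
  exact DFunLike.congr_fun h_comp ξ

theorem IsSchmidt.exists_unitary_antiunitary (h : IsSchmidt Φ r b' b)
    (hΦ : tensorFlip K K Φ = σ • Φ) :
    ∃ (w : K ≃ₗᵢ[ℂ] K) (c : K ≃ₗᵢ⋆[ℂ] K), (∀ k, w (b k) = b' k) ∧ (∀ k, c (b k) = b k) ∧
      ∀ η, w η = σ • c.symm (w.symm (c η)) := by
  classical
  let w : K ≃ₗᵢ[ℂ] K := b.repr.trans b'.repr.symm
  let c : K ≃ₗᵢ⋆[ℂ] K := antiunitaryOfBases b b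
  have hw k : w (b k) = b' k := by
    change b'.repr.symm (b.repr (b k)) = b' k
    rw [b.repr_self, b'.repr_symm_single]
  have hc : ∀ k, c (b k) = b k := antiunitaryOfBases_apply b b
  have hcc η : c (c η) = η := by
    let cc : K →L⋆[ℂ] K := c
    have h_comp : cc.comp cc = .id ℂ K := ext_on_hilbertBasis b fun k => by
      change c (c (b k)) = b k
      rw [hc, hc]
    exact DFunLike.congr_fun h_comp η
  refine ⟨w, c, hw, hc, fun η => ?_⟩
  have h_sq : w (c (w (c (c.symm (w.symm (c η)))))) = σ • c.symm (w.symm (c η)) :=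
    h.antiunitary_apply_apply hΦ (θ := c.trans w) (fun k => by
      change w (c (b k)) = b' k
      rw [hc, hw]) _
  rwa [c.apply_symm_apply, w.apply_symm_apply, hcc] at h_sq

end SchmidtSign

namespace SpinChain

variable {K : Type*} [NormedAddCommGroup K] [InnerProductSpace ℂ K]
  {J : HilbertTensor K K ≃ₗᵢ⋆[ℂ] HilbertTensor K K} {θ θ' : K ≃ₗᵢ⋆[ℂ] K}

theorem antiConj_apply_apply (θ : K ≃ₗᵢ⋆[ℂ] K) (x : K →L[ℂ] K) (ξ : K) :
    antiConj θ x (θ ξ) = θ (x ξ) :=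
  congrArg (fun η => θ (x η)) (θ.symm_apply_apply ξ)

theorem implements_of_apply_tensorVec
    (h : ∀ e f, J (tensorVec (θ f) e) = tensorVec (θ e) f) : Implements J θ := by
  refine fun x => ext_tensorVec fun ξ f => ?_
  obtain ⟨e, rfl⟩ := θ.surjective ξ
  calc antiConj J (tensorOp (.id ℂ K) x) (tensorVec (θ e) f)
    _ = J (tensorOp (.id ℂ K) x (tensorVec (θ f) e)) := by rw [← h, antiConj_apply_apply]
    _ = tensorVec (θ (x e)) f := by rw [tensorOp_tensorVec, ContinuousLinearMap.id_apply, h]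
    _ = tensorOp (antiConj θ x) (.id ℂ K) (tensorVec (θ e) f) := by
      rw [tensorOp_tensorVec, antiConj_apply_apply, ContinuousLinearMap.id_apply]

theorem Implements.antiConj_eq [Nontrivial K] (h : Implements J θ) (h' : Implements J θ')
    (x : K →L[ℂ] K) : antiConj θ x = antiConj θ' x :=
  tensorOp_left_injective ((h x).symm.trans (h' x))

theorem exists_forall_apply_eq_smul_of_antiConj_eq [Nontrivial K]
    (h : ∀ x, antiConj θ x = antiConj θ' x) : ∃ c : ℂ, ∀ ξ, θ' ξ = c • θ ξ := by
  obtain ⟨η, hη⟩ := exists_norm_eq K zero_le_one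
  refine ⟨starRingEnd ℂ ⟪η, θ.symm (θ' η)⟫_ℂ, fun ξ => ?_⟩
  let x := InnerProductSpace.rankOne ℂ ξ η
  calc θ' ξ = antiConj θ' x (θ' η) := by
        rw [antiConj_apply_apply, InnerProductSpace.rankOne_apply,
          inner_self_eq_one_of_norm_eq_one hη, one_smul]
    _ = antiConj θ x (θ (θ.symm (θ' η))) := by rw [h, θ.apply_symm_apply]
    _ = starRingEnd ℂ ⟪η, θ.symm (θ' η)⟫_ℂ • θ ξ := by
        rw [antiConj_apply_apply, InnerProductSpace.rankOne_apply, map_smulₛₗ]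

theorem Implements.apply_apply_eq (h : Implements J θ) (h' : Implements J θ') (ξ : K) :
    θ' (θ' ξ) = θ (θ ξ) := by
  rcases subsingleton_or_nontrivial K with hK | hK
  · exact Subsingleton.elim _ _
  obtain ⟨c, hc⟩ := exists_forall_apply_eq_smul_of_antiConj_eq (h.antiConj_eq h')
  obtain ⟨η, hη⟩ := exists_norm_eq K zero_le_one
  have h_norm : ‖c‖ = 1 := by
    simpa only [norm_smul, LinearIsometryEquiv.norm_map, hη, mul_one] using
      (congrArg norm (hc η)).symm
  rw [hc, hc, map_smulₛₗ, smul_smul, Complex.mul_conj', h_norm, Complex.ofReal_one, one_pow,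
    one_smul]

end SpinChain

theorem tensorOp_id_orthogonal_span_apply {E F : Type*} [NormedAddCommGroup E]
    [InnerProductSpace ℂ E] [CompleteSpace E] [NormedAddCommGroup F] [InnerProductSpace ℂ F]
    [CompleteSpace F] {Φ : HilbertTensor E F} {η : F} (hη : antiOp Φ η = 0) :
    tensorOp (.id ℂ E) (ℂ ∙ η)ᗮ.starProjection Φ = Φ := by
  refine antiOp_injective (ContinuousLinearMap.ext fun x => ?_)
  have hx : x - (ℂ ∙ η)ᗮ.starProjection x ∈ ℂ ∙ η := by
    simpa only [Submodule.orthogonal_orthogonal] using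
      (ℂ ∙ η)ᗮ.sub_starProjection_mem_orthogonal x
  obtain ⟨c, hc⟩ := Submodule.mem_span_singleton.mp hx
  rw [antiOp_tensorOp, isStarProjection_starProjection.isSelfAdjoint.adjoint_eq,
    ContinuousLinearMap.id_apply, eq_comm, ← sub_eq_zero, ← map_sub, ← hc, map_smulₛₗ, hη,
    smul_zero]

theorem IsSupportProjection.eq_zero_of_antiOp_eq_zero {E F : Type*} [NormedAddCommGroup E]
    [InnerProductSpace ℂ E] [CompleteSpace E] [Nontrivial E] [NormedAddCommGroup F]
    [InnerProductSpace ℂ F] [CompleteSpace F] {Φ : HilbertTensor E F} {s : F →L[ℂ] F}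
    (h : IsSupportProjection (rightFactor E F) Φ (tensorOp (.id ℂ E) s)) {η : F}
    (hsη : s η = η) (hη : antiOp Φ η = 0) : η = 0 := by
  let r := (ℂ ∙ η)ᗮ.starProjection
  have hr : IsStarProjection (tensorOp (.id ℂ E) r) :=
    isStarProjection_tensorOp (.one _) isStarProjection_starProjection
  have h_le := h.le _ ⟨r, rfl⟩ hr (tensorOp_id_orthogonal_span_apply hη)
  rw [tensorOp_mul] at h_le
  have hrs : r * s = s := tensorOp_right_injective h_le
  have hrη : r η = η := by
    simpa only [mul_apply_eq_comp, hsη] using DFunLike.congr_fun hrs η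
  rwa [Submodule.starProjection_eq_self_iff, Submodule.mem_orthogonal_singleton_iff_inner_right,
    inner_self_eq_zero] at hrη

section FlipEigenvector

variable {K : Type*} [NormedAddCommGroup K] [InnerProductSpace ℂ K] {Φ : HilbertTensor K K} {σ : ℤ}

theorem tensorOp_apply_id_of_tensorFlip {s : K →L[ℂ] K} (hs : tensorOp (.id ℂ K) s Φ = Φ)
    (hΦ : tensorFlip K K Φ = σ • Φ) : tensorOp s (.id ℂ K) Φ = Φ := by
  rw [← tensorFlip_tensorFlip (tensorOp s _ Φ), tensorFlip_tensorOp, hΦ, map_zsmul, hs, ← hΦ,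
    tensorFlip_tensorFlip]

theorem antiOp_tensorFlip_injective [CompleteSpace K]
    (hinj : Function.Injective (antiOp Φ)) (hΦ : tensorFlip K K Φ = σ • Φ) :
    Function.Injective (antiOp (tensorFlip K K Φ)) := by
  refine (injective_iff_map_eq_zero _).mpr fun ξ hξ => (map_eq_zero_iff _ hinj).mp ?_
  rw [← tensorFlip_tensorFlip Φ, hΦ, map_zsmul, antiOp_zsmul_apply, hξ, smul_zero]

end FlipEigenvector

namespace SpinChain

theorem exists_implements_apply_apply {K : Type*} [NormedAddCommGroup K] [InnerProductSpace ℂ K]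
    [CompleteSpace K] {Φ : HilbertTensor K K} {J : HilbertTensor K K ≃ₗᵢ⋆[ℂ] HilbertTensor K K}
    {σ : ℤ} (hJ : IsModularConjugation (rightFactor K K) Φ J)
    (hinj : Function.Injective (antiOp Φ)) (hΦ : tensorFlip K K Φ = σ • Φ) :
    ∃ θ : K ≃ₗᵢ⋆[ℂ] K, Implements J θ ∧ ∀ ξ, θ (θ ξ) = σ • ξ := by
  obtain ⟨ι, r, b', b, h⟩ := exists_isSchmidt hinj (antiOp_tensorFlip_injective hinj hΦ)
  have hθ := antiunitaryOfBases_apply b b'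
  exact ⟨antiunitaryOfBases b b',
    implements_of_apply_tensorVec (h.modularConjugation_tensorVec_apply hJ hθ),
    h.antiunitary_apply_apply hΦ hθ⟩

section Corner

variable {H : Type*} [NormedAddCommGroup H] [InnerProductSpace ℂ H]
  {Ω : HilbertTensor H H} {s : H →L[ℂ] H} {σ : ℤ}

theorem apply_eq_self_of_mem_corner (hs : IsIdempotentElem s) {ξ : H} (hξ : ξ ∈ corner s) :
    s ξ = ξ := by
  obtain ⟨η, rfl⟩ := hξ
  exact DFunLike.congr_fun hs.eq η

theorem tensorFlip_cornerVec (hΩ : tensorFlip H H Ω = σ • Ω) :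
    tensorFlip (corner s) (corner s) (cornerVec s Ω) = σ • cornerVec s Ω := by
  rw [cornerVec, tensorFlip_tensorOp, hΩ, map_zsmul]

variable [CompleteSpace H]

theorem antiOp_mem_corner (hsΩ : tensorOp s (.id ℂ H) Ω = Ω) (η : H) :
    antiOp Ω η ∈ corner s := by
  rw [← hsΩ, antiOp_tensorOp]
  exact ⟨_, rfl⟩

theorem completeSpace_corner (hs : IsIdempotentElem s) : CompleteSpace (corner s) :=
  (ContinuousLinearMap.IsIdempotentElem.isClosed_range hs).completeSpace_coe

variable [CompleteSpace (corner s)]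

theorem adjoint_rangeRestrict_apply (hs : IsStarProjection s) (ξ : corner s) :
    ContinuousLinearMap.adjoint s.rangeRestrict ξ = (ξ : H) := by
  refine ext_inner_right ℂ fun η => ?_
  calc ⟪ContinuousLinearMap.adjoint s.rangeRestrict ξ, η⟫_ℂ
    _ = ⟪(ξ : H), s η⟫_ℂ := ContinuousLinearMap.adjoint_inner_left _ _ _
    _ = ⟪s (ξ : H), η⟫_ℂ := (hs.isSelfAdjoint.isSymmetric _ _).symm
    _ = ⟪(ξ : H), η⟫_ℂ := by rw [apply_eq_self_of_mem_corner hs.isIdempotentElem ξ.2]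

theorem coe_antiOp_cornerVec (hs : IsStarProjection s) (hsΩ : tensorOp s (.id ℂ H) Ω = Ω)
    (η : corner s) : (antiOp (cornerVec s Ω) η : H) = antiOp Ω (η : H) := by
  calc (antiOp (cornerVec s Ω) η : H)
    _ = s (antiOp Ω (η : H)) := by
      rw [cornerVec, antiOp_tensorOp, adjoint_rangeRestrict_apply hs]
      rfl
    _ = antiOp (tensorOp s (.id ℂ H) Ω) (η : H) := by
      rw [antiOp_tensorOp, ContinuousLinearMap.adjoint_id, ContinuousLinearMap.id_apply]
    _ = antiOp Ω (η : H) := by rw [hsΩ]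

theorem antiOp_cornerVec_injective (hs : IsStarProjection s)
    (hsupp : IsSupportProjection (rightFactor H H) Ω (tensorOp (.id ℂ H) s))
    (hΩ : tensorFlip H H Ω = σ • Ω) : Function.Injective (antiOp (cornerVec s Ω)) := by
  refine (injective_iff_map_eq_zero _).mpr fun η hη => Subtype.ext ?_
  rcases subsingleton_or_nontrivial H with hH | hH
  · exact Subsingleton.elim _ _
  refine hsupp.eq_zero_of_antiOp_eq_zero (apply_eq_self_of_mem_corner hs.isIdempotentElem η.2) ?_
  rw [← coe_antiOp_cornerVec hs (tensorOp_apply_id_of_tensorFlip hsupp.apply_eq hΩ), hη,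
    ZeroMemClass.coe_zero]

theorem exists_isSchmidt_cornerVec_of_hasSum (hs : IsStarProjection s)
    (hsupp : IsSupportProjection (rightFactor H H) Ω (tensorOp (.id ℂ H) s))
    (hΩ : tensorFlip H H Ω = σ • Ω) {ι : Type*} {r : ι → ℝ} {ξ ζ : ι → H} (hr : ∀ k, 0 < r k)
    (hξ : Orthonormal ℂ ξ) (hζ : Orthonormal ℂ ζ)
    (h : HasSum (fun k => (r k : ℂ) • tensorVec (ξ k) (ζ k)) Ω) :
    ∃ b' b : HilbertBasis ι ℂ (corner s), (∀ k, (b' k : H) = ξ k) ∧ (∀ k, (b k : H) = ζ k) ∧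
      IsSchmidt (cornerVec s Ω) r b' b := by
  have hinj := antiOp_cornerVec_injective hs hsupp hΩ
  have h_mem := antiOp_mem_corner (tensorOp_apply_id_of_tensorFlip hsupp.apply_eq hΩ)
  have hr0 k : (r k : ℂ) ≠ 0 := by exact_mod_cast (hr k).ne'
  have hξ_mem k : ξ k ∈ corner s := by
    rw [← Submodule.smul_mem_iff _ (hr0 k), ← antiOp_apply_eq_smul_of_hasSum hζ h]
    exact h_mem _
  have hζ_mem k : ζ k ∈ corner s := by
    rw [← Submodule.smul_mem_iff _ (hr0 k),
      ← antiOp_apply_eq_smul_of_hasSum hξ (hasSum_tensorFlip h), hΩ, antiOp_zsmul_apply]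
    exact zsmul_mem (h_mem _) σ
  have h_restrict {x : H} (hx : x ∈ corner s) : s.rangeRestrict x = ⟨x, hx⟩ :=
    Subtype.ext (apply_eq_self_of_mem_corner hs.isIdempotentElem hx)
  have h_corner : HasSum (fun k => (r k : ℂ) • tensorVec (⟨ξ k, hξ_mem k⟩ : corner s)
      (⟨ζ k, hζ_mem k⟩ : corner s)) (cornerVec s Ω) := by
    simpa only [map_smul, tensorOp_tensorVec, h_restrict (hξ_mem _), h_restrict (hζ_mem _),
      cornerVec] using h.mapL (tensorOp s.rangeRestrict s.rangeRestrict)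
  obtain ⟨b', b, hb', hb, h_schmidt⟩ := exists_isSchmidt_of_hasSum hinj
    (antiOp_tensorFlip_injective hinj (tensorFlip_cornerVec hΩ)) hr
    (hξ.codRestrict _ hξ_mem) (hζ.codRestrict _ hζ_mem) h_corner
  exact ⟨b', b, fun k => by rw [hb', Set.val_codRestrict_apply],
    fun k => by rw [hb, Set.val_codRestrict_apply], h_schmidt⟩

end Corner

end SpinChain

end

theorem theorem4p4 {d : ℕ} (hd : 2 ≤ d)
    (ω : SpinChain.Chain d →ₗ[ℂ] ℂ) (hpure : IsPureState ω)
    (hrefl : ∀ a, ω (SpinChain.reflection d a) = ω a) (hsplit : SpinChain.HasSplitProperty ω)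
    {H : Type u} [NormedAddCommGroup H] [InnerProductSpace ℂ H] [CompleteSpace H]
    (π : SpinChain.ChainR d →⋆ₐ[ℂ] (H →L[ℂ] H)) (Ω : HilbertTensor H H)
    (Γ : HilbertTensor H H ≃ₗᵢ[ℂ] HilbertTensor H H)
    (hrep : SpinChain.IsReflectionSplitRep ω π Ω Γ)
    (s : H →L[ℂ] H) (hs : IsStarProjection s)
    (hsupp : IsSupportProjection (rightFactor H H) Ω (tensorOp (ContinuousLinearMap.id ℂ H) s))
    (J : HilbertTensor (SpinChain.corner s) (SpinChain.corner s) ≃ₗᵢ⋆[ℂ]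
      HilbertTensor (SpinChain.corner s) (SpinChain.corner s))
    (hJ : IsModularConjugation (rightFactor (SpinChain.corner s) (SpinChain.corner s))
      (SpinChain.cornerVec s Ω) J) :
    -- the index is a sign, and it is the sign of the flip in the given representation
    (SpinChain.reflectionIndex.{u} ω = 1 ∨ SpinChain.reflectionIndex.{u} ω = -1) ∧
    (∀ ξ η : H, Γ (tensorVec ξ η) = SpinChain.reflectionIndex.{u} ω • tensorVec η ξ) ∧
    -- the sign `κ` of the anti-unitaries that implement `J` equals the index
    (∃ θ : SpinChain.corner s ≃ₗᵢ⋆[ℂ] SpinChain.corner s, SpinChain.Implements J θ) ∧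
    (∃ κ : ℤ, (κ = 1 ∨ κ = -1) ∧
      (∀ θ : SpinChain.corner s ≃ₗᵢ⋆[ℂ] SpinChain.corner s, SpinChain.Implements J θ →
        ∀ ξ, θ (θ ξ) = κ • ξ) ∧
      κ = SpinChain.reflectionIndex.{u} ω) ∧
    -- the index from a Schmidt decomposition
    (∀ (ι : Type v) (lam : ι → ℝ) (ξ ζ : ι → H), (∀ k, 0 < lam k) →
      Orthonormal ℂ ξ → Orthonormal ℂ ζ →
      HasSum (fun k => (Real.sqrt (lam k) : ℂ) • tensorVec (ξ k) (ζ k)) Ω →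
      ∃ (bξ bζ : HilbertBasis ι ℂ (SpinChain.corner s))
        (w : SpinChain.corner s ≃ₗᵢ[ℂ] SpinChain.corner s)
        (c : SpinChain.corner s ≃ₗᵢ⋆[ℂ] SpinChain.corner s),
        (∀ k, (bξ k : H) = ξ k) ∧ (∀ k, (bζ k : H) = ζ k) ∧
        (∀ k, w (bζ k) = bξ k) ∧ (∀ k, c (bζ k) = bζ k) ∧
        ∀ η, w η = SpinChain.reflectionIndex.{u} ω • c.symm (w.symm (c η))) := by
  obtain ⟨hσ, hindex⟩ := hrep.isReflectionIndex
  have hΓ := hindex H π Ω Γ hrep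
  have hΩ := hrep.tensorFlip_vector hσ hΓ
  have := SpinChain.completeSpace_corner hs.isIdempotentElem
  have hflip := SpinChain.tensorFlip_cornerVec (s := s) hΩ
  have hinj := SpinChain.antiOp_cornerVec_injective hs hsupp hΩ
  obtain ⟨θ, hθ, hθθ⟩ := SpinChain.exists_implements_apply_apply hJ hinj hflip
  refine ⟨hσ, hΓ, ⟨θ, hθ⟩, ⟨_, hσ, fun θ' hθ' ξ => ?_, rfl⟩, ?_⟩
  · rw [hθ.apply_apply_eq hθ', hθθ]
  · intro ι lam ξ ζ hlam hξ hζ hsum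
    obtain ⟨bξ, bζ, hbξ, hbζ, hb⟩ := SpinChain.exists_isSchmidt_cornerVec_of_hasSum hs hsupp hΩ
      (fun k => Real.sqrt_pos.mpr (hlam k)) hξ hζ hsum
    obtain ⟨w, c, hw, hc, hwc⟩ := hb.exists_unitary_antiunitary hflip
    exact ⟨bξ, bζ, w, c, hbξ, hbζ, hw, hc, hwc⟩
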